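/- Let $X,U$ be complex Banach spaces and $\mathbb R_+=[0,\infty)$. **Boundary control systems.** A (linear) boundary control system $(\mathfrak A,\mathfrak B)$ consists of a closed operator $\mathfrak A:D(\mathfrak A)\subset X\to X$ and a linear operator $\mathfrak B:D(\mathfrak A)\to U$ that is closed with respect to the graph norm $\|x\|+\|\mathfrak Ax\|$ on $D(\mathfrak A)$, such that $A:=\mathfrak A|_{\ker\mathfrak B}$ generates a $C_0$-semigroup $T$ on $X$ and $\mathfrak B$ has a right-inverse $B_0\in\mathcal L(U,D(\mathfrak A))$. For $\mu\in\rho(A)$ let $X_{-1}$ be the completion of $X$ in the norm $\|(\mu I-A)^{-1}\cdot\|$, let $T_{-1}(t)$ be the bounded extension of $T(t)$ to $X_{-1}$, $A_{-1}\in\mathcal L(X,X_{-1})$ the bounded extension of $A$, and $B:=\mathfrak AB_0-A_{-1}B_0\in\mathcal L(U,X_{-1})$. A *classical solution* for $x_0\in X$ and continuous $u:\mathbb R_+\to U$ is a function $x\in C^1(\mathbb R_+;X)\cap C(\mathbb R_+;D(\mathfrak A))$ with $x(0)=x_0$ and $\dot x(t)=\mathfrak Ax(t)$, $\mathfrak Bx(t)=u(t)$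 for all $t>0$. A *mild solution* for $x_0\in X$ and $u\in L^1_{\rm loc}(\mathbb R_+;U)$ is a function $x\in C(\mathbb R_+;X)$ such that, in $X_{-1}$, for all $t\ge0$, $$x(t)=T(t)x_0+\int_0^tT_{-1}(t-s)Bu(s)\,ds .$$ **Flows and ISS.** A *flow* $\Phi$ on a set $D\subset X\times U^{\mathbb R_+}$ of input data is a map $\Phi:\mathbb R_+\times D\to X$ with $\Phi(0,x,u)=x$; $\Phi(t+h,x,u)=\Phi(h,\Phi(t,x,u),u(t+\cdot))$ whenever $(x,u)\in D$ and $(\Phi(t,x,u),u(t+\cdot))\in D$; and $\Phi(t,x,u)=\Phi(t,x,u')$ whenever $(x,u),(x,u')\in D$ and $u=u'$ on $[0,t]$. It is a *dynamical control system* if moreover $(\Phi(t,x,u),u(t+\cdot))\in D$ for all $t\ge 0$ and $(x,u)\in D$. Classical (mild) solutions *define* a flow with data $D$ if for each $(x_0,u)\in D$ there is exactly one classical (mild) solution on $\mathbb R_+$, this solution being $\Phi(\cdot,x_0,u)$. For $q\in[1,\infty]$, $\Phi$ is *$L^q$-ISS* if there are $\beta\in\mathcal{KL}$, $\gamma\in\mathcal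 K$ with $$\|\Phi(t,x_0,u)\|\le\beta(\|x_0\|,t)+\gamma\big(\|u\|_{L^q(0,t;U)}\big)$$ for all $t>0$ and all $(x_0,u)\in D$ with $u\in L^q_{\rm loc}(\mathbb R_+;U)$. Here $\mathcal K$ is the set of continuous strictly increasing $\gamma:\mathbb R_+\to\mathbb R_+$ with $\gamma(0)=0$, and $\beta\in\mathcal{KL}$ means that $\beta(\cdot,t)\in\mathcal K$ for every $t\ge0$ and that $\beta(r,\cdot)$ is continuous, strictly decreasing and tends to $0$ for every $r>0$. **Proposition.** Let $(\mathfrak A,\mathfrak B)$ be a boundary control system, and let $T$, $A$, $B_0$, $B$ be as above, for an arbitrary right-inverse $B_0$ and arbitrary $\mu\in\rho(A)$. For every $q\in[1,\infty)$ the following are equivalent: 1. classical solutions define a flow with data $D(A)\times C_c^\infty((0,\infty);U)$, and it is $L^q$-ISS; 2. mild solutions define a dynamical control system with data $X\times L^q_{\rm loc}(\mathbb R_+;U)$, and it is $L^q$-ISS; 3. classical solutions define a dynamical control system with data $\{(x,u)\in D(\mathfrak A)\times W^{2,1}_{\rm loc}(\mathbb R_+;U):\mathfrak Bx=u(0)\}$,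 and it is $L^q$-ISS. Moreover, the following are equivalent: 1. classical solutions define a dynamical control system with data $\{(x,u)\in D(\mathfrak A)\times W^{2,1}_{\rm loc}(\mathbb R_+;U):\mathfrak Bx=u(0)\}$, and it is $L^\infty$-ISS; 2. mild solutions define a dynamical control system with data $X\times C(\mathbb R_+;U)$, and it is $L^\infty$-ISS. -/

import Mathlib

open Set Filter Topology MeasureTheory
open scoped NNReal ENNReal

noncomputable section

/-! ### Functions on the half-line `ℝ≥0 = [0, ∞)` -/

section HalfLine

variable {E : Type*}

/-- A function on `[0, ∞)` viewed as a function on `ℝ` (constant on `(-∞, 0]`), so that derivatives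
and integrals over subintervals of `[0, ∞)` can be written. Only its values on `[0, ∞)` are ever
used. -/
def onReal (f : ℝ≥0 → E) (s : ℝ) : E := f s.toNNReal

/-- The shifted function `u(t + ·)`. -/
def shiftBy (t : ℝ≥0) (u : ℝ≥0 → E) : ℝ≥0 → E := fun s => u (t + s)

variable [NormedAddCommGroup E]

/-- `u ∈ L^q_loc([0, ∞); E)`: the restriction to each `[0, t]` is (Bochner) measurable with finite
`L^q` norm. -/
def IsLocLq (q : ℝ≥0∞) (u : ℝ≥0 → E) : Prop :=
  ∀ t : ℝ≥0, MemLp (onReal u) q (volume.restrict (Icc (0 : ℝ) t))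

/-- The norm `‖u|_{[0,t]}‖_{L^q(0,t;E)}`, finite for `u ∈ L^q_loc`. -/
def lqNorm (q : ℝ≥0∞) (t : ℝ≥0) (u : ℝ≥0 → E) : ℝ≥0 :=
  (eLpNorm (onReal u) q (volume.restrict (Icc (0 : ℝ) t))).toNNReal

variable [NormedSpace ℂ E]

/-- `u ∈ W^{2,1}_loc([0, ∞); E)` (continuous representative): `u` is the primitive of a function `v`
which is itself the primitive of a locally Bochner integrable function `w`; here `v` and `w` are the
first and second weak derivatives of `u`. -/
def IsW21Loc (u : ℝ≥0 → E) : Prop :=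
  ∃ v w : ℝ≥0 → E, IsLocLq 1 w ∧
    (∀ t : ℝ≥0, v t = v 0 + ∫ s in (0 : ℝ)..t, onReal w s) ∧
    (∀ t : ℝ≥0, u t = u 0 + ∫ s in (0 : ℝ)..t, onReal v s)

/-- `u ∈ C_c^∞(0, ∞; E)`: smooth with compact support contained in the open half-line. -/
def IsTestInput (u : ℝ≥0 → E) : Prop :=
  ∃ φ : ℝ → E, ContDiff ℝ ((⊤ : ℕ∞) : WithTop ℕ∞) φ ∧ HasCompactSupport φ ∧ tsupport φ ⊆ Ioi (0 : ℝ) ∧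
    ∀ t : ℝ≥0, u t = φ t

end HalfLine

/-! ### Comparison functions, dynamical control systems and input-to-state stability -/

/-- The class `𝒦`. -/
structure IsClassK (γ : ℝ≥0 → ℝ≥0) : Prop where
  map_zero : γ 0 = 0
  continuous : Continuous γ
  strictMono : StrictMono γ

/-- The class `ℒ`. -/
structure IsClassL (θ : ℝ≥0 → ℝ≥0) : Prop where
  continuous : Continuous θ
  strictAnti : StrictAnti θ
  tendsto : Tendsto θ atTop (𝓝 0)

/-- The class `𝒦ℒ`. As `β (0, ·) = 0`, membership of `β (r, ·)` in `ℒ` is only required for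
`r > 0`. -/
structure IsClassKL (β : ℝ≥0 → ℝ≥0 → ℝ≥0) : Prop where
  classK : ∀ t, IsClassK fun r => β r t
  classL : ∀ r, 0 < r → IsClassL (β r)

/-- A semiflow with inputs on a set `data` of pairs (initial value, input function), without the
requirement that `data` is invariant: the cocycle identity is imposed whenever the pair (current
state, shifted input) is again in `data`. Only the values of `flow` on `data` matter. -/
structure ControlFlow (X U : Type*) where
  data : Set (X × (ℝ≥0 → U))
  flow : ℝ≥0 → X → (ℝ≥0 → U) → X
  flow_zero : ∀ x u, (x, u) ∈ data → flow 0 x u = x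
  flow_add : ∀ t h x u, (x, u) ∈ data → (flow t x u, shiftBy t u) ∈ data →
    flow (t + h) x u = flow h (flow t x u) (shiftBy t u)
  causal : ∀ t x u u', (x, u) ∈ data → (x, u') ∈ data → (∀ s ≤ t, u s = u' s) →
    flow t x u = flow t x u'

/-- A dynamical control system: a semiflow with inputs whose set of input data is invariant. -/
structure DynamicalControlSystem (X U : Type*) extends ControlFlow X U where
  invariant : ∀ t x u, (x, u) ∈ data → (flow t x u, shiftBy t u) ∈ data

namespace ControlFlow

variable {X U : Type*} [NormedAddCommGroup X] [NormedAddCommGroup U]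

/-- `L^q`-input-to-state stability. -/
def IsISS (F : ControlFlow X U) (q : ℝ≥0∞) : Prop :=
  ∃ (β : ℝ≥0 → ℝ≥0 → ℝ≥0) (γ : ℝ≥0 → ℝ≥0), IsClassKL β ∧ IsClassK γ ∧
    ∀ (t : ℝ≥0) (x : X) (u : ℝ≥0 → U), 0 < t → (x, u) ∈ F.data → IsLocLq q u →
      ‖F.flow t x u‖₊ ≤ β ‖x‖₊ t + γ (lqNorm q t u)

/-- The flow is the one defined by the solution concept `Sol` (`Sol x₀ u x` meaning that `x` is a
solution with initial value `x₀` and input `u`): for all data there is exactly one solution on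
`[0, ∞)`, and it is `t ↦ flow t x₀ u`. -/
def IsDefinedBy (F : ControlFlow X U) (Sol : X → (ℝ≥0 → U) → (ℝ≥0 → X) → Prop) : Prop :=
  ∀ x₀ u, (x₀, u) ∈ F.data → ∀ x, Sol x₀ u x ↔ x = fun t => F.flow t x₀ u

end ControlFlow

/-! ### Strongly continuous semigroups and the extrapolation space -/

section Semigroup

variable {X : Type*} [NormedAddCommGroup X] [NormedSpace ℂ X]

/-- A strongly continuous one-parameter semigroup of bounded operators. -/
structure C0Semigroup (X : Type*) [NormedAddCommGroup X] [NormedSpace ℂ X] where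
  op : ℝ≥0 → X →L[ℂ] X
  op_zero : op 0 = ContinuousLinearMap.id ℂ X
  op_add : ∀ s t, op (s + t) = (op s).comp (op t)
  continuous_op : ∀ x, Continuous fun t => op t x

/-- `A` is the generator of `T`: `x ∈ D(A)` with `A x = y` iff `(T(h) x - x) / h → y` as `h ↓ 0`. -/
def C0Semigroup.HasGenerator (T : C0Semigroup X) (A : X →ₗ.[ℂ] X) : Prop :=
  ∀ x y : X, (x, y) ∈ A.graph ↔
    Tendsto (fun h : ℝ => h⁻¹ • (T.op h.toNNReal x - x)) (𝓝[>] 0) (𝓝 y)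

/-- `R = (μ I - A)⁻¹`, a bounded operator on `X`. -/
def IsResolventAt (A : X →ₗ.[ℂ] X) (μ : ℂ) (R : X →L[ℂ] X) : Prop :=
  (∀ x : A.domain, R (μ • (x : X) - A x) = x) ∧
    ∀ y : X, ∃ x : A.domain, R y = x ∧ μ • (x : X) - A x = y

/-- The resolvent set `ρ(A)`. -/
def resolventSetOf (A : X →ₗ.[ℂ] X) : Set ℂ := {μ | ∃ R : X →L[ℂ] X, IsResolventAt A μ R}

open Classical in
/-- The resolvent operator `(μ I - A)⁻¹` for `μ ∈ ρ(A)` (and `0` otherwise). -/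
def resolventOp (A : X →ₗ.[ℂ] X) (μ : ℂ) : X →L[ℂ] X :=
  if h : ∃ R : X →L[ℂ] X, IsResolventAt A μ R then h.choose else 0

theorem isResolventAt_resolventOp {A : X →ₗ.[ℂ] X} {μ : ℂ} (hμ : μ ∈ resolventSetOf A) :
    IsResolventAt A μ (resolventOp A μ) := by
  have h : ∃ R : X →L[ℂ] X, IsResolventAt A μ R := hμ
  rw [resolventOp, dif_pos h]
  exact h.choose_spec

/-- A copy of `X`, to be equipped with the norm `‖(μ I - A)⁻¹ ·‖`. -/
def PreExtrap (_A : X →ₗ.[ℂ] X) (_μ : ℂ) : Type _ := X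

instance (A : X →ₗ.[ℂ] X) (μ : ℂ) : AddCommGroup (PreExtrap A μ) :=
  inferInstanceAs (AddCommGroup X)

instance (A : X →ₗ.[ℂ] X) (μ : ℂ) : Module ℂ (PreExtrap A μ) :=
  inferInstanceAs (Module ℂ X)

/-- The resolvent as a linear map on the copy of `X`. -/
def preExtrapMap (A : X →ₗ.[ℂ] X) (μ : ℂ) : PreExtrap A μ →ₗ[ℂ] X :=
  (resolventOp A μ : X →ₗ[ℂ] X)

instance (A : X →ₗ.[ℂ] X) (μ : ℂ) : SeminormedAddCommGroup (PreExtrap A μ) :=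
  SeminormedAddCommGroup.induced (PreExtrap A μ) X (preExtrapMap A μ)

instance (A : X →ₗ.[ℂ] X) (μ : ℂ) : NormedSpace ℂ (PreExtrap A μ) :=
  NormedSpace.induced ℂ (PreExtrap A μ) X (preExtrapMap A μ)

/-- The extrapolation space `X₋₁`: the completion of `X` in the norm `‖(μ I - A)⁻¹ ·‖`. -/
abbrev Extrap (A : X →ₗ.[ℂ] X) (μ : ℂ) : Type _ := UniformSpace.Completion (PreExtrap A μ)

/-- The canonical embedding `X → X₋₁` as a linear map. -/
def toExtrapLin (A : X →ₗ.[ℂ] X) (μ : ℂ) : X →ₗ[ℂ] Extrap A μ :=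
  ((UniformSpace.Completion.toComplL : PreExtrap A μ →L[ℂ] Extrap A μ) :
    PreExtrap A μ →ₗ[ℂ] Extrap A μ)

theorem norm_toExtrapLin (A : X →ₗ.[ℂ] X) (μ : ℂ) (x : X) :
    ‖toExtrapLin A μ x‖ = ‖resolventOp A μ x‖ :=
  UniformSpace.Completion.norm_coe (E := PreExtrap A μ) x

theorem denseRange_toExtrapLin (A : X →ₗ.[ℂ] X) (μ : ℂ) : DenseRange (toExtrapLin A μ) :=
  UniformSpace.Completion.denseRange_coe (α := PreExtrap A μ)

/-- The canonical embedding `X → X₋₁`. -/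
def toExtrap (A : X →ₗ.[ℂ] X) (μ : ℂ) : X →L[ℂ] Extrap A μ :=
  (toExtrapLin A μ).mkContinuous ‖resolventOp A μ‖ fun x => by
    rw [norm_toExtrapLin]
    exact (resolventOp A μ).le_opNorm x

/-- The operator `T₋₁(t)`: the unique bounded extension of `T(t)` to `X₋₁`. -/
def extrapSemigroup (T : C0Semigroup X) (A : X →ₗ.[ℂ] X) (μ : ℂ) (t : ℝ≥0) :
    Extrap A μ →L[ℂ] Extrap A μ :=
  (toExtrapLin A μ ∘ₗ (T.op t : X →ₗ[ℂ] X)).extendOfNorm (toExtrapLin A μ)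

/-- The operator `A₋₁ : X → X₋₁`: the unique extension of `A : D(A) → X ⊆ X₋₁` to a bounded operator
on `X`. -/
def extrapGenerator (A : X →ₗ.[ℂ] X) (μ : ℂ) : X →L[ℂ] Extrap A μ :=
  (toExtrapLin A μ ∘ₗ A.toFun).extendOfNorm A.domain.subtype

/-- The resolvent commutes with the semigroup. -/
theorem resolventOp_comm {T : C0Semigroup X} {A : X →ₗ.[ℂ] X} (hT : T.HasGenerator A) {μ : ℂ}
    (hμ : μ ∈ resolventSetOf A) (t : ℝ≥0) (y : X) :
    resolventOp A μ (T.op t y) = T.op t (resolventOp A μ y) := by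
  obtain ⟨h1, h2⟩ := isResolventAt_resolventOp hμ
  obtain ⟨x, hx, hxy⟩ := h2 y
  have hg : ((x : X), A x) ∈ A.graph := LinearPMap.mem_graph A x
  have hlim := (hT _ _).1 hg
  have hlim' : Tendsto (fun h : ℝ => h⁻¹ • (T.op h.toNNReal (T.op t x) - T.op t x)) (𝓝[>] 0)
      (𝓝 (T.op t (A x))) := by
    refine (((T.op t).continuous.tendsto _).comp hlim).congr fun h => ?_
    have hc : T.op h.toNNReal (T.op t x) = T.op t (T.op h.toNNReal x) := by
      rw [← ContinuousLinearMap.comp_apply, ← T.op_add, add_comm, T.op_add,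
        ContinuousLinearMap.comp_apply]
    rw [hc, Function.comp_apply, ← map_sub, ContinuousLinearMap.map_smul_of_tower]
  obtain ⟨z, hz1, hz2⟩ := (LinearPMap.mem_graph_iff A).1 ((hT _ _).2 hlim')
  have hz := h1 z
  dsimp only at hz1 hz2
  rw [hz1, hz2] at hz
  rw [hx, ← hz, ← map_smul, ← map_sub, hxy]

/-- `T₋₁(t)` extends `T(t)`. -/
theorem extrapSemigroup_toExtrap {T : C0Semigroup X} {A : X →ₗ.[ℂ] X} (hT : T.HasGenerator A)
    {μ : ℂ} (hμ : μ ∈ resolventSetOf A) (t : ℝ≥0) (x : X) :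
    extrapSemigroup T A μ t (toExtrap A μ x) = toExtrap A μ (T.op t x) := by
  refine LinearMap.extendOfNorm_eq (denseRange_toExtrapLin A μ) ⟨‖T.op t‖, fun y => ?_⟩ x
  rw [LinearMap.comp_apply, norm_toExtrapLin, norm_toExtrapLin, ContinuousLinearMap.coe_coe,
    resolventOp_comm hT hμ]
  exact (T.op t).le_opNorm _

/-- The domain of the generator is dense. -/
theorem dense_domain [CompleteSpace X] {T : C0Semigroup X} {A : X →ₗ.[ℂ] X}
    (hT : T.HasGenerator A) : Dense (A.domain : Set X) := by
  intro x
  let f : ℝ → X := fun s => T.op s.toNNReal x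
  have hf : Continuous f := (T.continuous_op x).comp continuous_real_toNNReal
  let F : ℝ → X := fun t => ∫ s in (0 : ℝ)..t, f s
  have hF : ∀ t, HasDerivAt F (f t) t := fun t =>
    intervalIntegral.integral_hasDerivAt_right (hf.intervalIntegrable _ _)
      (hf.stronglyMeasurableAtFilter _ _) hf.continuousAt
  have hf0 : f 0 = x := by simp [f, T.op_zero]
  have hmem : ∀ t : ℝ, 0 < t → F t ∈ A.domain := by
    intro t ht
    have key : ∀ h : ℝ, 0 < h → T.op h.toNNReal (F t) - F t = (F (t + h) - F t) - F h := by
      intro h hh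
      have e1 : T.op h.toNNReal (F t) = ∫ s in (0 : ℝ)..t, f (s + h) := by
        rw [← ContinuousLinearMap.intervalIntegral_comp_comm _ (hf.intervalIntegrable _ _)]
        refine intervalIntegral.integral_congr fun s hs => ?_
        rw [uIcc_of_le ht.le] at hs
        simp only [f]
        rw [← ContinuousLinearMap.comp_apply, ← T.op_add, Real.toNNReal_add hs.1 hh.le, add_comm]
      have e2 := intervalIntegral.integral_interval_sub_left (μ := volume)
        (hf.intervalIntegrable 0 (t + h)) (hf.intervalIntegrable 0 h)
      rw [e1, intervalIntegral.integral_comp_add_right, zero_add, ← e2]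
      simp only [F]
      abel
    have hlim : Tendsto (fun h : ℝ => h⁻¹ • (T.op h.toNNReal (F t) - F t)) (𝓝[>] 0)
        (𝓝 (f t - f 0)) := by
      have d1 := ((hF t).tendsto_slope_zero).mono_left
        (nhdsWithin_mono (0 : ℝ) (fun h (hh : h ∈ Ioi (0 : ℝ)) => (mem_Ioi.1 hh).ne'))
      have d2 := ((hF 0).tendsto_slope_zero).mono_left
        (nhdsWithin_mono (0 : ℝ) (fun h (hh : h ∈ Ioi (0 : ℝ)) => (mem_Ioi.1 hh).ne'))
      refine (d1.sub d2).congr' ?_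
      filter_upwards [self_mem_nhdsWithin] with h hh
      rw [key h hh, ← smul_sub]
      simp [F]
    obtain ⟨z, hz, -⟩ := (LinearPMap.mem_graph_iff A).1 ((hT _ _).2 hlim)
    dsimp only at hz
    rw [← hz]
    exact z.2
  have d0 := ((hF 0).tendsto_slope_zero).mono_left
    (nhdsWithin_mono (0 : ℝ) (fun h (hh : h ∈ Ioi (0 : ℝ)) => (mem_Ioi.1 hh).ne'))
  rw [hf0] at d0
  refine mem_closure_of_tendsto d0 ?_
  filter_upwards [self_mem_nhdsWithin] with h hh
  have h1 : F 0 = 0 := by simp [F]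
  rw [zero_add, h1, sub_zero, ← Complex.coe_smul]
  exact A.domain.smul_mem _ (hmem h hh)

/-- `A₋₁` extends `A`. -/
theorem extrapGenerator_apply [CompleteSpace X] {T : C0Semigroup X} {A : X →ₗ.[ℂ] X}
    (hT : T.HasGenerator A) {μ : ℂ} (hμ : μ ∈ resolventSetOf A) (x : A.domain) :
    extrapGenerator A μ x = toExtrap A μ (A x) := by
  have hd : DenseRange A.domain.subtype := (dense_domain hT).denseRange_val
  refine LinearMap.extendOfNorm_eq hd ⟨‖resolventOp A μ‖ * ‖μ‖ + 1, fun y => ?_⟩ x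
  have h := (isResolventAt_resolventOp hμ).1 y
  rw [map_sub, map_smul] at h
  have h' : resolventOp A μ (A y) = μ • resolventOp A μ (y : X) - y := by
    exact eq_sub_of_add_eq (by rw [add_comm]; exact (sub_eq_iff_eq_add.1 h).symm)
  rw [LinearMap.comp_apply, norm_toExtrapLin]
  change ‖resolventOp A μ (A y)‖ ≤ _ * ‖(y : X)‖
  rw [h']
  refine (norm_sub_le _ _).trans ?_
  rw [norm_smul]
  nlinarith [mul_le_mul_of_nonneg_left ((resolventOp A μ).le_opNorm (y : X)) (norm_nonneg μ)]

end Semigroup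

/-! ### Linear boundary control systems -/

/-- A linear boundary control system `(𝔄, 𝔅)`. Closedness of `𝔅 : D(𝔄) → U` refers to the graph
norm of `𝔄` on `D(𝔄)`. -/
structure BoundaryControlSystem (X U : Type*) [NormedAddCommGroup X] [NormedSpace ℂ X]
    [NormedAddCommGroup U] [NormedSpace ℂ U] where
  /-- the operator `𝔄 : D(𝔄) ⊆ X → X` -/
  opA : X →ₗ.[ℂ] X
  /-- the operator `𝔅 : D(𝔄) → U` -/
  opB : opA.domain →ₗ[ℂ] U
  closed_opA : opA.IsClosed
  closed_opB : IsClosed {p : (X × X) × U | ∃ x : opA.domain, p = (((x : X), opA x), opB x)}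
  /-- `𝔄|_{ker 𝔅}` generates a strongly continuous semigroup -/
  generates : ∃ T : C0Semigroup X,
    T.HasGenerator (opA.domRestrict ((LinearMap.ker opB).map opA.domain.subtype))
  /-- `𝔅` has a right-inverse `B₀` that is bounded from `U` to `D(𝔄)` with the graph norm -/
  right_invertible : ∃ B₀ : U →ₗ[ℂ] opA.domain, Continuous (fun v => (B₀ v : X)) ∧
    Continuous (fun v => opA (B₀ v)) ∧ ∀ v, opB (B₀ v) = v

namespace BoundaryControlSystem

variable {X U : Type*} [NormedAddCommGroup X] [NormedSpace ℂ X]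
  [NormedAddCommGroup U] [NormedSpace ℂ U] (S : BoundaryControlSystem X U)

/-- The operator `A = 𝔄|_{ker 𝔅}`. -/
def gen : X →ₗ.[ℂ] X :=
  S.opA.domRestrict ((LinearMap.ker S.opB).map S.opA.domain.subtype)

/-- A right-inverse `B₀ ∈ ℒ(U, D(𝔄))` of `𝔅`. -/
structure RightInverse where
  lin : U →ₗ[ℂ] S.opA.domain
  continuous_lin : Continuous fun v => (lin v : X)
  continuous_opA_lin : Continuous fun v => S.opA (lin v)
  opB_lin : ∀ v, S.opB (lin v) = v

variable {S}

/-- `B₀` as a bounded operator from `U` to `X`. -/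
def RightInverse.toX (B₀ : S.RightInverse) : U →L[ℂ] X :=
  ⟨S.opA.domain.subtype ∘ₗ B₀.lin, B₀.continuous_lin⟩

/-- `𝔄 B₀` as a bounded operator from `U` to `X`. -/
def RightInverse.opAToX (B₀ : S.RightInverse) : U →L[ℂ] X :=
  ⟨S.opA.toFun ∘ₗ B₀.lin, B₀.continuous_opA_lin⟩

/-- The operator `B = 𝔄 B₀ - A₋₁ B₀ ∈ ℒ(U, X₋₁)`. -/
def RightInverse.inputOp (B₀ : S.RightInverse) (μ : ℂ) : U →L[ℂ] Extrap S.gen μ :=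
  (toExtrap S.gen μ).comp B₀.opAToX - (extrapGenerator S.gen μ).comp B₀.toX

variable (S)

/-- `x` is a classical solution on `[0, ∞)` of `x' = 𝔄 x`, `𝔅 x = u`, `x(0) = x₀`:
`x ∈ C¹([0,∞); X) ∩ C([0,∞); D(𝔄))`, and the equations hold pointwise. -/
def IsClassicalSolution (x₀ : X) (u : ℝ≥0 → U) (x : ℝ≥0 → X) : Prop :=
  Continuous u ∧ Continuous x ∧ x 0 = x₀ ∧
    ∃ (x' : ℝ≥0 → X) (hx : ∀ t, x t ∈ S.opA.domain),
      Continuous x' ∧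
      (∀ t : ℝ≥0, HasDerivWithinAt (onReal x) (x' t) (Ici 0) t) ∧
      Continuous (fun t => S.opA ⟨x t, hx t⟩) ∧
      ∀ t, 0 < t → x' t = S.opA ⟨x t, hx t⟩ ∧ S.opB ⟨x t, hx t⟩ = u t

variable {S} in
/-- `x` is a (continuous) mild solution: `x : [0, ∞) → X` is continuous and
`x(t) = T(t) x₀ + ∫₀ᵗ T₋₁(t - s) B u(s) ds` in `X₋₁`, with `B = 𝔄 B₀ - A₋₁ B₀`. -/
def IsMildSolution (T : C0Semigroup X) (B₀ : S.RightInverse) (μ : ℂ)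
    (x₀ : X) (u : ℝ≥0 → U) (x : ℝ≥0 → X) : Prop :=
  IsLocLq 1 u ∧ Continuous x ∧
    ∀ t : ℝ≥0, toExtrap S.gen μ (x t) = toExtrap S.gen μ (T.op t x₀) +
      ∫ s in (0 : ℝ)..t,
        extrapSemigroup T S.gen μ ((t : ℝ) - s).toNNReal (B₀.inputOp μ (onReal u s))

/-- The data `D(A) × C_c^∞(0, ∞; U)`. -/
def testData : Set (X × (ℝ≥0 → U)) := {p | p.1 ∈ S.gen.domain ∧ IsTestInput p.2}

/-- The data `{(x, u) ∈ D(𝔄) × W^{2,1}_loc([0, ∞); U) : 𝔅 x = u(0)}`. -/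
def compatibleData : Set (X × (ℝ≥0 → U)) :=
  {p | (∃ h : p.1 ∈ S.opA.domain, S.opB ⟨p.1, h⟩ = p.2 0) ∧ IsW21Loc p.2}

/-- The classical solutions with data `D(A) × C_c^∞` define an `L^q`-ISS flow. The data set is not
invariant, so the flow is a restriction of the semiflow of classical solutions. -/
def ClassicalTestISS (q : ℝ≥0∞) : Prop :=
  ∃ F : ControlFlow X U, F.data = S.testData ∧ F.IsDefinedBy S.IsClassicalSolution ∧ F.IsISS q

/-- The classical solutions with compatible data in `D(𝔄) × W^{2,1}_loc` define an `L^q`-ISS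
dynamical control system. -/
def ClassicalCompatibleISS (q : ℝ≥0∞) : Prop :=
  ∃ F : DynamicalControlSystem X U, F.data = S.compatibleData ∧
    F.IsDefinedBy S.IsClassicalSolution ∧ F.IsISS q

variable {S} in
/-- The mild solutions with data in `X × 𝒰` define an `L^q`-ISS dynamical control system. -/
def MildISS (T : C0Semigroup X) (B₀ : S.RightInverse) (μ : ℂ) (inputs : Set (ℝ≥0 → U))
    (q : ℝ≥0∞) : Prop :=
  ∃ F : DynamicalControlSystem X U, F.data = univ ×ˢ inputs ∧
    F.IsDefinedBy (IsMildSolution T B₀ μ) ∧ F.IsISS q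

end BoundaryControlSystem

end

namespace C0Semigroup

/-! ### Semigroups and the variation of constants integral -/

variable {X : Type*} [NormedAddCommGroup X] [NormedSpace ℂ X]

theorem op_add_apply (T : C0Semigroup X) (s t : ℝ≥0) (x : X) :
    T.op (s + t) x = T.op s (T.op t x) := by
  rw [T.op_add, ContinuousLinearMap.comp_apply]

theorem op_toNNReal_add (T : C0Semigroup X) {s t : ℝ} (hs : 0 ≤ s) (ht : 0 ≤ t) (x : X) :
    T.op (s + t).toNNReal x = T.op s.toNNReal (T.op t.toNNReal x) := by
  rw [Real.toNNReal_add hs ht, op_add_apply]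

theorem continuous_op_toNNReal (T : C0Semigroup X) (x : X) : Continuous fun s : ℝ => T.op s.toNNReal x :=
  (T.continuous_op x).comp continuous_real_toNNReal

theorem exists_norm_op_le [CompleteSpace X] (T : C0Semigroup X) (t : ℝ≥0) :
    ∃ M : ℝ, 0 ≤ M ∧ ∀ s ≤ t, ‖T.op s‖ ≤ M := by
  obtain ⟨M, hM⟩ := banach_steinhaus (g := fun s : Set.Icc (0 : ℝ≥0) t => T.op s) fun x => by
    obtain ⟨C, hC⟩ := (isCompact_Icc (a := (0 : ℝ≥0)) (b := t)).exists_bound_of_continuousOn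
      (T.continuous_op x).continuousOn
    exact ⟨C, fun s => hC s s.2⟩
  exact ⟨M, (norm_nonneg _).trans (hM ⟨0, le_rfl, zero_le⟩),
    fun s hs => hM ⟨s, zero_le, hs⟩⟩

/-- Strong continuity is joint continuity. -/
theorem continuous_op_uncurry [CompleteSpace X] (T : C0Semigroup X) :
    Continuous fun p : ℝ≥0 × X => T.op p.1 p.2 := by
  rw [continuous_iff_continuousAt]
  rintro ⟨t, x⟩
  obtain ⟨M, hM0, hM⟩ := T.exists_norm_op_le (t + 1)
  have h1 : Tendsto (fun p : ℝ≥0 × X => T.op p.1 x) (𝓝 (t, x)) (𝓝 (T.op t x)) :=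
    ((T.continuous_op x).comp continuous_fst).continuousAt
  have h2 : Tendsto (fun p : ℝ≥0 × X => T.op p.1 (p.2 - x)) (𝓝 (t, x)) (𝓝 0) := by
    refine squeeze_zero_norm' (a := fun p : ℝ≥0 × X => M * ‖p.2 - x‖) ?_ ?_
    · have : ∀ᶠ p : ℝ≥0 × X in 𝓝 (t, x), p.1 < t + 1 :=
        continuous_fst.continuousAt.eventually (gt_mem_nhds (by simp))
      filter_upwards [this] with p hp
      exact (T.op p.1).le_of_opNorm_le (hM _ hp.le) _
    · have : Continuous fun p : ℝ≥0 × X => M * ‖p.2 - x‖ := by fun_prop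
      simpa using this.tendsto (t, x)
  have h3 := h1.add h2
  simp only [map_sub, add_sub_cancel, add_zero] at h3
  exact h3

/-- The right derivative of an orbit starting in the range of the resolvent. -/
theorem hasDerivWithinAt_op_resolvent {T : C0Semigroup X} {A : X →ₗ.[ℂ] X} {μ : ℂ} {t : ℝ}
    (hT : T.HasGenerator A) (hμ : μ ∈ resolventSetOf A)
    (x : X) (ht : 0 ≤ t) :
    HasDerivWithinAt (fun s : ℝ => T.op s.toNNReal (resolventOp A μ x))
      (T.op t.toNNReal (μ • resolventOp A μ x - x)) (Ioi t) t := by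
  obtain ⟨-, h2⟩ := isResolventAt_resolventOp hμ
  obtain ⟨y, hy, hyx⟩ := h2 x
  have hA : A y = μ • resolventOp A μ x - x := by rw [hy, ← hyx]; abel
  have hlim := (hT _ _).1 (LinearPMap.mem_graph A y)
  rw [hA, ← hy] at hlim
  rw [hasDerivWithinAt_iff_tendsto_slope' self_notMem_Ioi]
  have hsub : Tendsto (fun s : ℝ => s - t) (𝓝[>] t) (𝓝[>] 0) := by
    refine tendsto_nhdsWithin_iff.2 ⟨?_, ?_⟩
    · have : Continuous fun s : ℝ => s - t := by fun_prop
      simpa using (this.tendsto t).mono_left nhdsWithin_le_nhds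
    · filter_upwards [self_mem_nhdsWithin] with s hs
      exact sub_pos.2 (mem_Ioi.1 hs)
  refine (((T.op t.toNNReal).continuous.tendsto _).comp (hlim.comp hsub)).congr' ?_
  filter_upwards [self_mem_nhdsWithin] with s hs
  have hs' : t < s := hs
  rw [slope_def_module]
  simp only [Function.comp_apply]
  rw [ContinuousLinearMap.map_smul_of_tower, map_sub,
    ← T.op_toNNReal_add ht (sub_nonneg.2 hs'.le), add_sub_cancel]

/-- The variation of constants integral `∫₀ᵗ T(t - s) f(s) ds`. -/
noncomputable def duhamel (T : C0Semigroup X) (f : ℝ → X) (t : ℝ) : X :=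
  ∫ s in (0 : ℝ)..t, T.op (t - s).toNNReal (f s)

variable [CompleteSpace X] (T : C0Semigroup X) {f g : ℝ → X} {t h : ℝ}

theorem aestronglyMeasurable_op_comp {α : Type*} [MeasurableSpace α] {ν : Measure α}
    {τ : α → ℝ} {f : α → X} (hτ : AEStronglyMeasurable τ ν) (hf : AEStronglyMeasurable f ν) :
    AEStronglyMeasurable (fun a => T.op (τ a).toNNReal (f a)) ν :=
  T.continuous_op_uncurry.comp_aestronglyMeasurable
    ((continuous_real_toNNReal.comp_aestronglyMeasurable hτ).prodMk hf)

theorem intervalIntegrable_duhamel (ht : 0 ≤ t) (hf : IntervalIntegrable f volume 0 t) :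
    IntervalIntegrable (fun s => T.op (t - s).toNNReal (f s)) volume 0 t := by
  obtain ⟨M, hM0, hM⟩ := T.exists_norm_op_le t.toNNReal
  rw [intervalIntegrable_iff_integrableOn_Ioc_of_le ht] at hf ⊢
  refine (hf.norm.const_mul M).mono'
    (T.aestronglyMeasurable_op_comp (by fun_prop) hf.aestronglyMeasurable) ?_
  filter_upwards [ae_restrict_mem measurableSet_Ioc] with s hs
  exact (T.op _).le_of_opNorm_le (hM _ (Real.toNNReal_le_toNNReal (by linarith [hs.1]))) _

theorem duhamel_sub (ht : 0 ≤ t) (hf : IntervalIntegrable f volume 0 t)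
    (hg : IntervalIntegrable g volume 0 t) :
    T.duhamel (fun s => f s - g s) t = T.duhamel f t - T.duhamel g t := by
  simp only [duhamel, map_sub]
  exact intervalIntegral.integral_sub (T.intervalIntegrable_duhamel ht hf)
    (T.intervalIntegrable_duhamel ht hg)

theorem exists_norm_duhamel_le (t : ℝ) : ∃ M : ℝ, 0 ≤ M ∧ ∀ f : ℝ → X, ∀ s, 0 ≤ s → s ≤ t →
    IntervalIntegrable f volume 0 s → ‖T.duhamel f s‖ ≤ M * ∫ r in (0 : ℝ)..s, ‖f r‖ := by
  obtain ⟨M, hM0, hM⟩ := T.exists_norm_op_le t.toNNReal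
  refine ⟨M, hM0, fun f s hs hst hf => ?_⟩
  rw [duhamel, ← intervalIntegral.integral_const_mul]
  refine intervalIntegral.norm_integral_le_of_norm_le hs ?_ (hf.norm.const_mul M)
  refine ae_of_all _ fun r hr => ?_
  exact (T.op _).le_of_opNorm_le (hM _ (Real.toNNReal_le_toNNReal (by linarith [hr.1]))) _

/-- The cocycle identity of the variation of constants integral. -/
theorem duhamel_add (ht : 0 ≤ t) (hh : 0 ≤ h) (hf : IntervalIntegrable f volume 0 (t + h)) :
    T.duhamel f (t + h) = T.op h.toNNReal (T.duhamel f t) + T.duhamel (fun s => f (t + s)) h := by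
  have hth : 0 ≤ t + h := by positivity
  have hI := T.intervalIntegrable_duhamel hth hf
  have h1 : IntervalIntegrable (fun s => T.op (t + h - s).toNNReal (f s)) volume 0 t :=
    hI.mono_set (by rw [uIcc_of_le ht, uIcc_of_le hth]; exact Icc_subset_Icc le_rfl (by linarith))
  have h2 : IntervalIntegrable (fun s => T.op (t + h - s).toNNReal (f s)) volume t (t + h) :=
    hI.mono_set (by
      rw [uIcc_of_le (by linarith), uIcc_of_le hth]; exact Icc_subset_Icc ht le_rfl)
  have h3 : IntervalIntegrable f volume 0 t :=
    hf.mono_set (by rw [uIcc_of_le ht, uIcc_of_le hth]; exact Icc_subset_Icc le_rfl (by linarith))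
  rw [duhamel, ← intervalIntegral.integral_add_adjacent_intervals h1 h2]
  congr 1
  · rw [duhamel, ← ContinuousLinearMap.intervalIntegral_comp_comm _
      (T.intervalIntegrable_duhamel ht h3)]
    refine intervalIntegral.integral_congr fun s hs => ?_
    rw [uIcc_of_le ht] at hs
    rw [← T.op_toNNReal_add hh (by linarith [hs.2])]
    congr 3
    ring
  · have := intervalIntegral.integral_comp_add_left (a := 0) (b := h)
      (fun s => T.op (t + h - s).toNNReal (f s)) t
    rw [add_zero] at this
    rw [← this, duhamel]
    refine intervalIntegral.integral_congr fun s _ => ?_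
    congr 3
    ring

theorem continuousOn_duhamel {b : ℝ} (hb : 0 ≤ b) (hf : IntervalIntegrable f volume 0 b) :
    ContinuousOn (T.duhamel f) (Icc 0 b) := by
  obtain ⟨M, hM0, hM⟩ := T.exists_norm_op_le b.toNNReal
  have hf' := (intervalIntegrable_iff_integrableOn_Ioc_of_le hb).1 hf
  -- The indicator turns the variable upper limit into a fixed interval. For fixed `s` the integrand
  -- can jump in `t` only at `t = s`, so at each `t₀` it is continuous for almost every `s`, and
  -- dominated convergence applies.
  let G : ℝ → ℝ → X := fun t => (Iic t).indicator fun s => T.op (t - s).toNNReal (f s)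
  have key : ContinuousOn (fun t => ∫ s in Ioc 0 b, G t s) (Icc 0 b) := by
    intro t₀ ht₀
    refine continuousWithinAt_of_dominated (bound := fun s => M * ‖f s‖) ?_ ?_
      (hf'.norm.const_mul M) ?_
    · exact Eventually.of_forall fun t => (T.aestronglyMeasurable_op_comp (by fun_prop)
        hf'.aestronglyMeasurable).indicator measurableSet_Iic
    · filter_upwards [self_mem_nhdsWithin] with t ht
      filter_upwards [ae_restrict_mem measurableSet_Ioc] with s hs
      refine (norm_indicator_le_norm_self _ _).trans ?_
      exact (T.op _).le_of_opNorm_le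
        (hM _ (Real.toNNReal_le_toNNReal (by linarith [hs.1, ht.2]))) _
    · have hne : ∀ᵐ s ∂(volume.restrict (Ioc 0 b)), s ≠ t₀ := Measure.ae_ne _ t₀
      filter_upwards [hne] with s hs
      refine ContinuousAt.continuousWithinAt ?_
      rcases lt_or_gt_of_ne hs with hlt | hlt
      · have hc : ContinuousAt (fun t : ℝ => T.op (t - s).toNNReal (f s)) t₀ :=
          ((T.continuous_op (f s)).comp (continuous_real_toNNReal.comp (by fun_prop))).continuousAt
        refine hc.congr ?_
        filter_upwards [lt_mem_nhds hlt] with t ht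
        exact (indicator_of_mem (mem_Iic.2 ht.le) (fun s => T.op (t - s).toNNReal (f s))).symm
      · refine (continuousAt_const (y := (0 : X))).congr ?_
        filter_upwards [gt_mem_nhds hlt] with t ht
        exact (indicator_of_notMem (by simpa using ht) (fun s => T.op (t - s).toNNReal (f s))).symm
  refine key.congr fun t ht => ?_
  have : Iic t ∩ Ioc 0 b = Ioc 0 t := by
    ext s
    simp only [mem_inter_iff, mem_Iic, mem_Ioc]
    exact ⟨fun hs => ⟨hs.2.1, hs.1⟩, fun hs => ⟨hs.2, hs.1, hs.2.trans ht.2⟩⟩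
  simp only [G]
  rw [duhamel, intervalIntegral.integral_of_le ht.1, integral_indicator measurableSet_Iic,
    Measure.restrict_restrict measurableSet_Iic, this]

/-! ### Generator and resolvent -/

variable {T} {A : X →ₗ.[ℂ] X} {μ : ℂ}

/-- The fundamental theorem of calculus with one-sided derivatives suffices here. The two-sided
derivative then follows, because the orbit is the primitive of a continuous function. -/
theorem integral_op_resolvent (hT : T.HasGenerator A) (hμ : μ ∈ resolventSetOf A)
    (x : X) (ht : 0 ≤ t) :
    ∫ s in (0 : ℝ)..t, T.op s.toNNReal (μ • resolventOp A μ x - x) =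
      T.op t.toNNReal (resolventOp A μ x) - resolventOp A μ x := by
  rw [intervalIntegral.integral_eq_sub_of_hasDeriv_right_of_le ht
    (T.continuous_op_toNNReal (resolventOp A μ x)).continuousOn
    (fun s hs => hasDerivWithinAt_op_resolvent hT hμ x hs.1.le)
    ((T.continuous_op_toNNReal _).intervalIntegrable _ _)]
  simp [T.op_zero]

/-- Two-sided derivative of an orbit starting in the range of the resolvent. -/
theorem hasDerivAt_op_resolvent (hT : T.HasGenerator A) (hμ : μ ∈ resolventSetOf A)
    (x : X) (ht : 0 < t) :
    HasDerivAt (fun s : ℝ => T.op s.toNNReal (resolventOp A μ x))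
      (T.op t.toNNReal (μ • resolventOp A μ x - x)) t := by
  have hc : Continuous fun s : ℝ => T.op s.toNNReal (μ • resolventOp A μ x - x) :=
    T.continuous_op_toNNReal _
  have h := (intervalIntegral.integral_hasDerivAt_right (hc.intervalIntegrable 0 t)
    (hc.stronglyMeasurableAtFilter _ _) hc.continuousAt).add_const (resolventOp A μ x)
  refine h.congr_of_eventuallyEq ?_
  filter_upwards [lt_mem_nhds ht] with s hs
  rw [integral_op_resolvent hT hμ x hs.le, sub_add_cancel]

/-- The variation of constants formula, integrated in time, after application of `A R`, where
`A R = μ R - 1`. -/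
theorem integral_duhamel_resolvent (hT : T.HasGenerator A) (hμ : μ ∈ resolventSetOf A)
    (ht : 0 ≤ t) (hg : IntervalIntegrable g volume 0 t) :
    ∫ s in (0 : ℝ)..t, (μ • resolventOp A μ (T.duhamel g s) - T.duhamel g s) =
      resolventOp A μ (T.duhamel g t) - resolventOp A μ (∫ s in (0 : ℝ)..t, g s) := by
  set R := resolventOp A μ with hR
  let C : X →L[ℂ] X := μ • R - ContinuousLinearMap.id ℂ X
  have hC : ∀ x, C x = μ • R x - x := fun x => by simp [C]
  obtain ⟨M, hM0, hM⟩ := T.exists_norm_op_le t.toNNReal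
  have hg' := (intervalIntegrable_iff_integrableOn_Ioc_of_le ht).1 hg
  -- Extending the integrand by zero from the triangle `r ≤ s` to the square prepares Fubini. After
  -- the swap, the integral over `s ∈ [r, t]` is the integrated orbit of `R (g r)`; no
  -- differentiability of the convolution is needed, which matters because `g` is merely integrable.
  let G : ℝ → ℝ → X := fun s => (Iic s).indicator fun r => T.op (s - r).toNNReal (C (g r))
  have hin : ∀ s ∈ Icc 0 t, C (T.duhamel g s) = ∫ r in Ioc 0 t, G s r := by
    intro s hs
    have hset : Iic s ∩ Ioc 0 t = Ioc 0 s := by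
      ext r
      simp only [mem_inter_iff, mem_Iic, mem_Ioc]
      exact ⟨fun h => ⟨h.2.1, h.1⟩, fun h => ⟨h.2, h.1, h.2.trans hs.2⟩⟩
    have hgs : IntervalIntegrable g volume 0 s := hg.mono_set (by
      rw [uIcc_of_le ht, uIcc_of_le hs.1]; exact Icc_subset_Icc le_rfl hs.2)
    simp only [G]
    rw [integral_indicator measurableSet_Iic, Measure.restrict_restrict measurableSet_Iic, hset,
      duhamel, ← ContinuousLinearMap.intervalIntegral_comp_comm _
        (T.intervalIntegrable_duhamel hs.1 hgs), intervalIntegral.integral_of_le hs.1]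
    refine integral_congr_ae (ae_of_all _ fun r => ?_)
    simp only [hC, map_sub, map_smul]
    rw [hR, resolventOp_comm hT hμ]
  have hswap : ∫ s in Ioc 0 t, ∫ r in Ioc 0 t, G s r = ∫ r in Ioc 0 t, ∫ s in Ioc 0 t, G s r := by
    refine integral_integral_swap ?_
    have hgI : Integrable (fun p : ℝ × ℝ => M * (‖C‖ * ‖g p.2‖))
        ((volume.restrict (Ioc 0 t)).prod (volume.restrict (Ioc 0 t))) :=
      ((hg'.norm.const_mul ‖C‖).const_mul M).comp_snd _
    refine hgI.mono' ?_ ?_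
    · have : Function.uncurry G = {p : ℝ × ℝ | p.2 ≤ p.1}.indicator
          fun p => T.op (p.1 - p.2).toNNReal (C (g p.2)) := by
        ext p
        simp only [Function.uncurry, G, indicator, mem_Iic, mem_ofPred_eq]
      rw [this]
      refine (T.aestronglyMeasurable_op_comp (by fun_prop)
        (C.continuous.comp_aestronglyMeasurable hg'.aestronglyMeasurable.comp_snd)).indicator ?_
      exact measurableSet_le measurable_snd measurable_fst
    · have h1 : ∀ᵐ p ∂((volume.restrict (Ioc 0 t)).prod (volume.restrict (Ioc 0 t))),
          p ∈ Ioc (0 : ℝ) t ×ˢ Ioc (0 : ℝ) t := by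
        rw [Measure.prod_restrict]
        exact ae_restrict_mem (measurableSet_Ioc.prod measurableSet_Ioc)
      filter_upwards [h1] with p hp
      refine (norm_indicator_le_norm_self (fun r => T.op (p.1 - r).toNNReal (C (g r))) _).trans ?_
      refine ((T.op _).le_of_opNorm_le
        (hM _ (Real.toNNReal_le_toNNReal (by linarith [hp.1.2, hp.2.1]))) _).trans ?_
      exact mul_le_mul_of_nonneg_left (C.le_opNorm _) hM0
  have hout : ∀ r ∈ Ioc 0 t, ∫ s in Ioc 0 t, G s r =
      T.op (t - r).toNNReal (R (g r)) - R (g r) := by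
    intro r hr
    have hG : (fun s => G s r) = (Ici r).indicator fun s => T.op (s - r).toNNReal (C (g r)) := by
      ext s
      simp only [G, indicator, mem_Iic, mem_Ici]
    have hset : Ici r ∩ Ioc 0 t = Icc r t := by
      ext s
      simp only [mem_inter_iff, mem_Ici, mem_Icc, mem_Ioc]
      exact ⟨fun h => ⟨h.1, h.2.2⟩, fun h => ⟨h.1, hr.1.trans_le h.1, h.2⟩⟩
    rw [hG, integral_indicator measurableSet_Ici, Measure.restrict_restrict measurableSet_Ici,
      hset, integral_Icc_eq_integral_Ioc, ← intervalIntegral.integral_of_le hr.2,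
      intervalIntegral.integral_comp_sub_right (fun s => T.op s.toNNReal (C (g r))) r, sub_self]
    simp only [hC]
    exact integral_op_resolvent hT hμ (g r) (sub_nonneg.2 hr.2)
  calc ∫ s in (0 : ℝ)..t, (μ • R (T.duhamel g s) - T.duhamel g s)
      = ∫ s in Ioc 0 t, ∫ r in Ioc 0 t, G s r := by
        rw [intervalIntegral.integral_of_le ht]
        refine setIntegral_congr_fun measurableSet_Ioc fun s hs => ?_
        rw [← hC, hin s (Ioc_subset_Icc_self hs)]
    _ = ∫ r in (0 : ℝ)..t, (R (T.op (t - r).toNNReal (g r)) - R (g r)) := by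
        rw [hswap, intervalIntegral.integral_of_le ht]
        refine setIntegral_congr_fun measurableSet_Ioc fun r hr => ?_
        rw [hout r hr, hR, resolventOp_comm hT hμ]
    _ = R (T.duhamel g t) - R (∫ s in (0 : ℝ)..t, g s) := by
        have hI := T.intervalIntegrable_duhamel ht hg
        simp only [← map_sub]
        rw [ContinuousLinearMap.intervalIntegral_comp_comm _ (hI.sub hg),
          intervalIntegral.integral_sub hI hg]
        rfl

end C0Semigroup

/-! ### The extrapolation space seen through the resolvent -/

noncomputable section

section Resolvent

variable {X : Type*} [NormedAddCommGroup X] [NormedSpace ℂ X] {A : X →ₗ.[ℂ] X} {μ : ℂ}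

theorem resolventOp_injective (hμ : μ ∈ resolventSetOf A) :
    Function.Injective (resolventOp A μ) := by
  rw [injective_iff_map_eq_zero]
  intro y hy
  obtain ⟨x, hx, hxy⟩ := (isResolventAt_resolventOp hμ).2 y
  have : x = 0 := Subtype.ext (hx.symm.trans hy)
  rw [← hxy, this]
  simp

/-- The extension of the resolvent to an isometry of `X₋₁` into `X`. -/
def extrapResolvent [CompleteSpace X] (A : X →ₗ.[ℂ] X) (μ : ℂ) : Extrap A μ →L[ℂ] X :=
  (resolventOp A μ : X →ₗ[ℂ] X).extendOfNorm (toExtrapLin A μ)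

variable [CompleteSpace X]

theorem extrapResolvent_toExtrap (x : X) :
    extrapResolvent A μ (toExtrap A μ x) = resolventOp A μ x :=
  LinearMap.extendOfNorm_eq (denseRange_toExtrapLin A μ)
    ⟨1, fun y => by rw [norm_toExtrapLin, one_mul]; rfl⟩ x

theorem norm_extrapResolvent (y : Extrap A μ) : ‖extrapResolvent A μ y‖ = ‖y‖ := by
  refine (denseRange_toExtrapLin A μ).induction_on y
    (isClosed_eq (extrapResolvent A μ).continuous.norm continuous_norm) fun x => ?_
  rw [norm_toExtrapLin]
  exact congrArg norm (extrapResolvent_toExtrap x)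

theorem extrapResolvent_injective : Function.Injective (extrapResolvent A μ) :=
  (injective_iff_map_eq_zero _).2 fun y hy => norm_eq_zero.1 (by
    rw [← norm_extrapResolvent, hy, norm_zero])

/-- An isometry commutes with the Bochner integral even for non-integrable functions, so the
integrand in `X₋₁` needs no measurability check. -/
theorem extrapResolvent_integral {α : Type*} [MeasurableSpace α] (ν : Measure α)
    (f : α → Extrap A μ) :
    extrapResolvent A μ (∫ a, f a ∂ν) = ∫ a, extrapResolvent A μ (f a) ∂ν :=
  ((LinearIsometry.mk (extrapResolvent A μ : Extrap A μ →ₗ[ℂ] X)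
    norm_extrapResolvent).integral_comp_comm f).symm

theorem extrapResolvent_extrapSemigroup {T : C0Semigroup X} (hT : T.HasGenerator A)
    (hμ : μ ∈ resolventSetOf A) (t : ℝ≥0) (y : Extrap A μ) :
    extrapResolvent A μ (extrapSemigroup T A μ t y) = T.op t (extrapResolvent A μ y) := by
  refine (denseRange_toExtrapLin A μ).induction_on y
    (isClosed_eq (by fun_prop) (by fun_prop)) fun x => ?_
  change extrapResolvent A μ (extrapSemigroup T A μ t (toExtrap A μ x)) =
    T.op t (extrapResolvent A μ (toExtrap A μ x))
  rw [extrapSemigroup_toExtrap hT hμ, extrapResolvent_toExtrap, extrapResolvent_toExtrap,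
    resolventOp_comm hT hμ]

/-- On `D(A)` this is `R A = μ R - 1`; both sides are continuous on `X` and `D(A)` is dense. -/
theorem extrapResolvent_extrapGenerator {T : C0Semigroup X} (hT : T.HasGenerator A)
    (hμ : μ ∈ resolventSetOf A) (x : X) :
    extrapResolvent A μ (extrapGenerator A μ x) = μ • resolventOp A μ x - x := by
  refine (dense_domain hT).denseRange_val.induction_on x
    (isClosed_eq (by fun_prop) (by fun_prop)) fun x => ?_
  rw [extrapGenerator_apply hT hμ, extrapResolvent_toExtrap]
  have h := (isResolventAt_resolventOp hμ).1 x
  rw [map_sub, map_smul] at h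
  rw [eq_sub_iff_add_eq, add_comm, ← sub_eq_iff_eq_add.1 h]

end Resolvent

/-! ### The Dirichlet operator and the mild equation in `X` -/

namespace BoundaryControlSystem

variable {X U : Type*} [NormedAddCommGroup X] [NormedSpace ℂ X]
  [NormedAddCommGroup U] [NormedSpace ℂ U] {S : BoundaryControlSystem X U}

theorem mem_gen_domain {x : X} :
    x ∈ S.gen.domain ↔ ∃ h : x ∈ S.opA.domain, S.opB ⟨x, h⟩ = 0 := by
  constructor
  · rintro ⟨⟨y, hy, rfl⟩, h⟩
    exact ⟨h, hy⟩
  · rintro ⟨h, hB⟩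
    exact ⟨⟨⟨x, h⟩, hB, rfl⟩, h⟩

theorem gen_apply (x : S.gen.domain) (h : (x : X) ∈ S.opA.domain) : S.gen x = S.opA ⟨x, h⟩ := rfl

theorem resolventOp_spec {μ : ℂ} (hμ : μ ∈ resolventSetOf S.gen) (y : X) :
    ∃ h : resolventOp S.gen μ y ∈ S.opA.domain, S.opB ⟨_, h⟩ = 0 ∧
      S.opA ⟨_, h⟩ = μ • resolventOp S.gen μ y - y := by
  obtain ⟨x, hx, hxy⟩ := (isResolventAt_resolventOp hμ).2 y
  obtain ⟨h, hB⟩ := mem_gen_domain.1 x.2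
  rw [gen_apply x h] at hxy
  have e : (⟨x, h⟩ : S.opA.domain) = ⟨resolventOp S.gen μ y, hx ▸ h⟩ := Subtype.ext hx.symm
  rw [e] at hxy hB
  refine ⟨hx ▸ h, hB, ?_⟩
  refine eq_sub_of_add_eq' ?_
  rw [← sub_eq_iff_eq_add.1 hxy, hx]

theorem resolventOp_of_opB_eq_zero {μ : ℂ} (hμ : μ ∈ resolventSetOf S.gen) (x : S.opA.domain)
    (hx : S.opB x = 0) : resolventOp S.gen μ (μ • (x : X) - S.opA x) = x :=
  (isResolventAt_resolventOp hμ).1 ⟨x, mem_gen_domain.2 ⟨x.2, hx⟩⟩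

/-- The solution operator `K` of the stationary problem `𝔄 K v = μ K v`, `𝔅 K v = v`. -/
def RightInverse.dirichlet (B₀ : S.RightInverse) (μ : ℂ) : U →L[ℂ] X :=
  (resolventOp S.gen μ).comp (B₀.opAToX - μ • B₀.toX) + B₀.toX

namespace RightInverse

variable (B₀ : S.RightInverse) {μ : ℂ}

/-- The lift `B₀ v` has the right boundary value but leaves the defect `𝔄 B₀ v - μ B₀ v`. Adding `R`
of this defect removes it without changing the boundary value, as `R` maps into `ker 𝔅`. -/
theorem dirichlet_spec (hμ : μ ∈ resolventSetOf S.gen) (v : U) :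
    ∃ h : B₀.dirichlet μ v ∈ S.opA.domain, S.opB ⟨_, h⟩ = v ∧
      S.opA ⟨_, h⟩ = μ • B₀.dirichlet μ v := by
  obtain ⟨h, hB, hA⟩ := resolventOp_spec hμ (S.opA (B₀.lin v) - μ • (B₀.lin v : X))
  have e : B₀.dirichlet μ v = ((⟨_, h⟩ + B₀.lin v : S.opA.domain) : X) := rfl
  refine ⟨e ▸ Subtype.mem _, ?_, ?_⟩
  · have : (⟨B₀.dirichlet μ v, e ▸ Subtype.mem _⟩ : S.opA.domain) = ⟨_, h⟩ + B₀.lin v := rfl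
    rw [this, map_add, hB, B₀.opB_lin, zero_add]
  · have : (⟨B₀.dirichlet μ v, e ▸ Subtype.mem _⟩ : S.opA.domain) = ⟨_, h⟩ + B₀.lin v := rfl
    rw [this, LinearPMap.map_add, hA, e, Submodule.coe_add, smul_add]
    abel

theorem extrapResolvent_inputOp [CompleteSpace X] {T : C0Semigroup X}
    (hT : T.HasGenerator S.gen) (hμ : μ ∈ resolventSetOf S.gen) (v : U) :
    extrapResolvent S.gen μ (B₀.inputOp μ v) = B₀.dirichlet μ v := by
  simp only [inputOp, dirichlet, sub_apply, add_apply,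
    ContinuousLinearMap.comp_apply, smul_apply, map_sub, map_smul]
  rw [extrapResolvent_toExtrap, extrapResolvent_extrapGenerator hT hμ]
  abel

end RightInverse

variable [CompleteSpace X] {T : C0Semigroup X} {B₀ : S.RightInverse} {μ : ℂ}
  {x₀ : X} {u : ℝ≥0 → U} {x : ℝ≥0 → X}

/-- Mild solutions, described in `X` instead of `X₋₁`. -/
theorem isMildSolution_iff (hT : T.HasGenerator S.gen) (hμ : μ ∈ resolventSetOf S.gen) :
    IsMildSolution T B₀ μ x₀ u x ↔ IsLocLq 1 u ∧ Continuous x ∧ ∀ t : ℝ≥0,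
      resolventOp S.gen μ (x t) = T.op t (resolventOp S.gen μ x₀) +
        T.duhamel (fun s => B₀.dirichlet μ (onReal u s)) t := by
  refine and_congr_right fun _ => and_congr_right fun _ => forall_congr' fun t => ?_
  rw [← extrapResolvent_injective.eq_iff, map_add, extrapResolvent_toExtrap,
    extrapResolvent_toExtrap, resolventOp_comm hT hμ,
    intervalIntegral.integral_of_le t.coe_nonneg, extrapResolvent_integral, C0Semigroup.duhamel,
    intervalIntegral.integral_of_le t.coe_nonneg]
  simp only [extrapResolvent_extrapSemigroup hT hμ, B₀.extrapResolvent_inputOp hT hμ]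

end BoundaryControlSystem


/-! ### Inputs on the half-line: local integrability, shifts and differences -/

section HalfLine

variable {E : Type*}

theorem onReal_of_nonneg (f : ℝ → E) {s : ℝ} (hs : 0 ≤ s) :
    onReal (fun t : ℝ≥0 => f t) s = f s := by
  rw [onReal, Real.coe_toNNReal s hs]

@[simp] theorem onReal_coe (f : ℝ≥0 → E) (t : ℝ≥0) : onReal f t = f t := by
  rw [onReal, Real.toNNReal_coe]

theorem continuous_onReal [TopologicalSpace E] {f : ℝ≥0 → E} (hf : Continuous f) :
    Continuous (onReal f) :=
  hf.comp continuous_real_toNNReal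

theorem continuous_comp_coe_of_continuousOn_Icc [TopologicalSpace E] {f : ℝ → E}
    (hf : ∀ b : ℝ≥0, ContinuousOn f (Icc 0 b)) : Continuous fun t : ℝ≥0 => f t := by
  rw [continuous_iff_continuousAt]
  intro t
  have h1 : ContinuousWithinAt f (Icc 0 ((t + 1 : ℝ≥0) : ℝ)) t :=
    hf (t + 1) t ⟨t.2, by simp⟩
  refine h1.tendsto.comp (tendsto_nhdsWithin_iff.2
    ⟨NNReal.continuous_coe.tendsto t, ?_⟩)
  filter_upwards [gt_mem_nhds (show t < t + 1 by simp)] with s hs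
  exact ⟨s.2, NNReal.coe_le_coe.2 hs.le⟩

theorem shiftBy_onReal (t : ℝ≥0) (u : ℝ≥0 → E) {s : ℝ} (hs : 0 ≤ s) :
    onReal (shiftBy t u) s = onReal u (t + s) := by
  rw [onReal, onReal, shiftBy, Real.toNNReal_add t.coe_nonneg hs, Real.toNNReal_coe]

variable [NormedAddCommGroup E] {q : ℝ≥0∞} {u v : ℝ≥0 → E}

theorem IsLocLq.intervalIntegrable (hu : IsLocLq 1 u) (t : ℝ≥0) :
    IntervalIntegrable (onReal u) volume 0 t :=
  (intervalIntegrable_iff_integrableOn_Icc_of_le t.coe_nonneg).2 (memLp_one_iff_integrable.1 (hu t))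

theorem IsLocLq.isLocLq_one (hu : IsLocLq q u) (hq : 1 ≤ q) : IsLocLq 1 u := fun t =>
  (hu t).mono_exponent hq

theorem IsLocLq.sub (hu : IsLocLq q u) (hv : IsLocLq q v) : IsLocLq q (u - v) := fun t =>
  (hu t).sub (hv t)

theorem isLocLq_of_continuous (hu : Continuous u) : IsLocLq q u := fun t => by
  obtain ⟨C, hC⟩ := (isCompact_Icc (a := (0 : ℝ)) (b := t)).exists_bound_of_continuousOn
    (continuous_onReal hu).continuousOn
  refine MemLp.of_bound (continuous_onReal hu).aestronglyMeasurable C ?_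
  filter_upwards [ae_restrict_mem measurableSet_Icc] with s hs
  exact hC s hs

theorem IsLocLq.shiftBy (hu : IsLocLq q u) (t : ℝ≥0) : IsLocLq q (shiftBy t u) := fun s => by
  have h1 : MemLp (onReal u) q (volume.restrict (Icc (t : ℝ) (t + s))) :=
    (hu (t + s)).mono_measure (Measure.restrict_mono (Icc_subset_Icc t.coe_nonneg le_rfl) le_rfl)
  have h2 := (measurePreserving_add_left volume (t : ℝ)).restrict_preimage
    (measurableSet_Icc (a := (t : ℝ)) (b := t + s))
  have h3 : (fun r : ℝ => (t : ℝ) + r) ⁻¹' Icc (t : ℝ) (t + s) = Icc 0 (s : ℝ) := by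
    ext r
    simp
  rw [h3] at h2
  refine (memLp_congr_ae ?_).1 (h1.comp_measurePreserving h2)
  filter_upwards [ae_restrict_mem measurableSet_Icc] with r hr
  exact (shiftBy_onReal t u hr.1).symm

variable [NormedSpace ℂ E]

theorem IsLocLq.continuous_primitive (hu : IsLocLq 1 u) :
    Continuous fun t : ℝ≥0 => ∫ s in (0 : ℝ)..t, onReal u s := by
  refine continuous_comp_coe_of_continuousOn_Icc (f := fun t => ∫ s in (0 : ℝ)..t, onReal u s)
    fun b => ?_
  have := intervalIntegral.continuousOn_primitive_interval' (hu.intervalIntegrable b)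
    (left_mem_uIcc)
  rwa [uIcc_of_le b.coe_nonneg] at this

theorem IsW21Loc.continuous (hu : IsW21Loc u) : Continuous u := by
  obtain ⟨v, w, hw, hv, hu⟩ := hu
  have hv' : Continuous v := by
    rw [funext hv]
    exact continuous_const.add hw.continuous_primitive
  rw [funext hu]
  exact continuous_const.add (isLocLq_of_continuous hv').continuous_primitive

theorem shiftBy_primitive (hv : IsLocLq 1 v)
    (hu : ∀ t : ℝ≥0, u t = u 0 + ∫ s in (0 : ℝ)..t, onReal v s) (t s : ℝ≥0) :
    shiftBy t u s = shiftBy t u 0 + ∫ r in (0 : ℝ)..s, onReal (shiftBy t v) r := by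
  have h1 : ∫ r in (0 : ℝ)..s, onReal (shiftBy t v) r = ∫ r in (t : ℝ)..(t + s), onReal v r := by
    have := intervalIntegral.integral_comp_add_left (a := 0) (b := (s : ℝ)) (onReal v) t
    rw [add_zero] at this
    rw [← this]
    refine intervalIntegral.integral_congr fun r hr => ?_
    rw [uIcc_of_le s.coe_nonneg] at hr
    exact shiftBy_onReal t v hr.1
  have h2 := hv.intervalIntegrable t
  have h3 := hv.intervalIntegrable (t + s)
  rw [NNReal.coe_add] at h3
  have h4 := intervalIntegral.integral_add_adjacent_intervals h2 (h2.symm.trans h3)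
  rw [h1, shiftBy, shiftBy, hu (t + s), add_zero, hu t, NNReal.coe_add, ← h4, add_assoc]

theorem IsW21Loc.shiftBy (hu : IsW21Loc u) (t : ℝ≥0) : IsW21Loc (shiftBy t u) := by
  obtain ⟨v, w, hw, hv, hu⟩ := hu
  have hv' : Continuous v := by
    rw [funext hv]
    exact continuous_const.add hw.continuous_primitive
  exact ⟨_, _, hw.shiftBy t, shiftBy_primitive hw hv t,
    shiftBy_primitive (isLocLq_of_continuous hv') hu t⟩

theorem isW21Loc_of_contDiff [CompleteSpace E] {φ : ℝ → E} (hφ : ContDiff ℝ 2 φ) :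
    IsW21Loc fun t : ℝ≥0 => φ t := by
  have hd : ∀ {ψ : ℝ → E}, ContDiff ℝ 1 ψ → ∀ t : ℝ≥0, ψ t = ψ (0 : ℝ≥0) +
      ∫ s in (0 : ℝ)..t, onReal (fun s : ℝ≥0 => deriv ψ s) s := by
    intro ψ hψ t
    have : ∫ s in (0 : ℝ)..t, onReal (fun s : ℝ≥0 => deriv ψ s) s =
        ∫ s in (0 : ℝ)..t, deriv ψ s :=
      intervalIntegral.integral_congr fun s hs => by
        rw [uIcc_of_le t.coe_nonneg] at hs
        exact onReal_of_nonneg _ hs.1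
    rw [this, intervalIntegral.integral_deriv_eq_sub
      (fun s _ => (hψ.differentiable one_ne_zero).differentiableAt)
      ((hψ.continuous_deriv le_rfl).intervalIntegrable _ _)]
    simp
  have h1 : ContDiff ℝ 1 (deriv φ) := (contDiff_succ_iff_deriv (n := 1).1 hφ).2.2
  exact ⟨fun t => deriv φ t, fun t => deriv (deriv φ) t, isLocLq_of_continuous
    ((h1.continuous_deriv le_rfl).comp NNReal.continuous_coe), hd h1, hd (hφ.of_le (by norm_num))⟩

theorem IsW21Loc.sub [CompleteSpace E] (hu : IsW21Loc u) (hv : IsW21Loc v) :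
    IsW21Loc (u - v) := by
  obtain ⟨u₁, u₂, hu₂, h1, h2⟩ := hu
  obtain ⟨v₁, v₂, hv₂, k1, k2⟩ := hv
  have hd : ∀ {a a' b b' : ℝ≥0 → E}, IsLocLq 1 a' → IsLocLq 1 b' →
      (∀ t : ℝ≥0, a t = a 0 + ∫ s in (0 : ℝ)..t, onReal a' s) →
      (∀ t : ℝ≥0, b t = b 0 + ∫ s in (0 : ℝ)..t, onReal b' s) →
      ∀ t : ℝ≥0, (a - b) t = (a - b) 0 + ∫ s in (0 : ℝ)..t, onReal (a' - b') s := by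
    intro a a' b b' ha' hb' ha hb t
    have : ∫ s in (0 : ℝ)..t, onReal (a' - b') s =
        (∫ s in (0 : ℝ)..t, onReal a' s) - ∫ s in (0 : ℝ)..t, onReal b' s :=
      intervalIntegral.integral_sub (ha'.intervalIntegrable t) (hb'.intervalIntegrable t)
    rw [this, Pi.sub_apply, Pi.sub_apply, ha t, hb t]
    abel
  have hc : ∀ {a a' : ℝ≥0 → E}, IsLocLq 1 a' →
      (∀ t : ℝ≥0, a t = a 0 + ∫ s in (0 : ℝ)..t, onReal a' s) → IsLocLq 1 a := by
    intro a a' ha' ha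
    refine isLocLq_of_continuous ?_
    rw [funext ha]
    exact continuous_const.add ha'.continuous_primitive
  exact ⟨u₁ - v₁, u₂ - v₂, hu₂.sub hv₂, hd hu₂ hv₂ h1 k1, hd (hc hu₂ h1) (hc hv₂ k1) h2 k2⟩

theorem IsTestInput.isW21Loc [CompleteSpace E] (hu : IsTestInput u) : IsW21Loc u := by
  obtain ⟨φ, hφ, -, -, h⟩ := hu
  rw [funext h]
  exact isW21Loc_of_contDiff (contDiff_infty.1 hφ 2)

theorem IsTestInput.apply_zero (hu : IsTestInput u) : u 0 = 0 := by
  obtain ⟨φ, -, -, hs, h⟩ := hu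
  rw [h]
  exact image_eq_zero_of_notMem_tsupport fun h0 => (mem_Ioi.1 (hs h0)).false

theorem IsTestInput.sub (hu : IsTestInput u) (hv : IsTestInput v) : IsTestInput (u - v) := by
  obtain ⟨φ, hφ, cφ, sφ, hu⟩ := hu
  obtain ⟨ψ, hψ, cψ, sψ, hv⟩ := hv
  exact ⟨φ - ψ, hφ.sub hψ, cφ.sub cψ, (tsupport_sub φ ψ).trans (union_subset sφ sψ),
    fun t => by rw [Pi.sub_apply, Pi.sub_apply, hu, hv]⟩

end HalfLine


/-- Product rule for `s ↦ T(t - s) R y(s)`. -/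
theorem C0Semigroup.hasDerivAt_op_sub_resolvent {X : Type*} [NormedAddCommGroup X]
    [NormedSpace ℂ X] [CompleteSpace X] {T : C0Semigroup X} {A : X →ₗ.[ℂ] X} {μ : ℂ}
    (hT : T.HasGenerator A) (hμ : μ ∈ resolventSetOf A) {y : ℝ → X} {y' : X} {s t : ℝ}
    (hs : s < t) (hy : HasDerivAt y y' s) :
    HasDerivAt (fun r => T.op (t - r).toNNReal (resolventOp A μ (y r)))
      (T.op (t - s).toNNReal (resolventOp A μ y' - (μ • resolventOp A μ (y s) - y s))) s := by
  have h1 : HasDerivAt (fun r => T.op (t - r).toNNReal (resolventOp A μ (y s)))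
      (-T.op (t - s).toNNReal (μ • resolventOp A μ (y s) - y s)) s := by
    have := (hasDerivAt_op_resolvent hT hμ (y s) (sub_pos.2 hs)).scomp s
      ((hasDerivAt_id s).const_sub t)
    rwa [neg_one_smul] at this
  rw [hasDerivAt_iff_tendsto_slope] at h1 hy ⊢
  -- The difference quotient of the product splits so that the semigroup acts at the moving time `t
  -- - r` on the quotient of `R y`. Its limit uses joint continuity of `(τ, z) ↦ T(τ) z`.
  have h2 : Tendsto (fun r : ℝ => ((t - r).toNNReal, resolventOp A μ (slope y s r))) (𝓝[≠] s)
      (𝓝 ((t - s).toNNReal, resolventOp A μ y')) := by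
    refine Tendsto.prodMk_nhds ?_ (((resolventOp A μ).continuous.tendsto _).comp hy)
    have : Continuous fun r : ℝ => (t - r).toNNReal := by fun_prop
    exact (this.tendsto s).mono_left nhdsWithin_le_nhds
  have h3 := ((T.continuous_op_uncurry.tendsto _).comp h2).add h1
  rw [map_sub, sub_eq_add_neg]
  refine h3.congr fun r => ?_
  simp only [Function.comp_apply, slope_def_module, ContinuousLinearMap.map_smul_of_tower, map_sub,
    ← smul_add]
  congr 1
  abel

/-! ### Properties of mild solutions and existence of classical ones -/

namespace BoundaryControlSystem

variable {X U : Type*} [NormedAddCommGroup X] [NormedSpace ℂ X]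
  [NormedAddCommGroup U] [NormedSpace ℂ U] {S : BoundaryControlSystem X U}
  {T : C0Semigroup X} {B₀ : S.RightInverse} {μ : ℂ}
  {x₀ y₀ : X} {u v : ℝ≥0 → U} {x y : ℝ≥0 → X}

theorem RightInverse.intervalIntegrable_dirichlet (B₀ : S.RightInverse) (μ : ℂ)
    (hu : IsLocLq 1 u) (t : ℝ≥0) :
    IntervalIntegrable (fun s => B₀.dirichlet μ (onReal u s)) volume 0 t :=
  ⟨(B₀.dirichlet μ).integrable_comp (hu.intervalIntegrable t).1,
    (B₀.dirichlet μ).integrable_comp (hu.intervalIntegrable t).2⟩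

/-- Subtracting `K 𝔅 z` from `z` gives an element of `ker 𝔅`, where `R` inverts `μ - 𝔄`; the
subtracted part is annihilated by `μ - 𝔄`. -/
theorem resolventOp_of_opB_eq (hμ : μ ∈ resolventSetOf S.gen) (B₀ : S.RightInverse)
    (z : S.opA.domain) :
    resolventOp S.gen μ (μ • (z : X) - S.opA z) = z - B₀.dirichlet μ (S.opB z) := by
  obtain ⟨h, hB, hA⟩ := B₀.dirichlet_spec hμ (S.opB z)
  have := resolventOp_of_opB_eq_zero hμ (z - ⟨_, h⟩) (by rw [map_sub, hB, sub_self])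
  rw [Submodule.coe_sub, LinearPMap.map_sub, hA] at this
  rw [← this]
  congr 1
  rw [smul_sub]
  abel

theorem IsClassicalSolution.mem_compatibleData (hx : S.IsClassicalSolution x₀ u x)
    (h : (x₀, u) ∈ S.compatibleData) (t : ℝ≥0) : (x t, shiftBy t u) ∈ S.compatibleData := by
  obtain ⟨-, -, hx0, x', hdom, -, -, -, heq⟩ := hx
  refine ⟨?_, h.2.shiftBy t⟩
  -- The boundary equation is part of a classical solution only for `t > 0`; at `t = 0` the
  -- compatibility of the data replaces it.
  rcases eq_zero_or_pos t with rfl | ht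
  · simpa [hx0, shiftBy] using h.1
  · exact ⟨hdom t, by simpa [shiftBy] using (heq t ht).2⟩

variable [CompleteSpace X]

theorem IsMildSolution.unique (hT : T.HasGenerator S.gen) (hμ : μ ∈ resolventSetOf S.gen)
    (hx : IsMildSolution T B₀ μ x₀ u x) (hy : IsMildSolution T B₀ μ x₀ u y) : x = y := by
  rw [isMildSolution_iff hT hμ] at hx hy
  funext t
  exact resolventOp_injective hμ ((hx.2.2 t).trans (hy.2.2 t).symm)

theorem IsMildSolution.apply_zero (hT : T.HasGenerator S.gen) (hμ : μ ∈ resolventSetOf S.gen)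
    (hx : IsMildSolution T B₀ μ x₀ u x) : x 0 = x₀ := by
  rw [isMildSolution_iff hT hμ] at hx
  refine resolventOp_injective hμ ?_
  rw [hx.2.2 0]
  simp [C0Semigroup.duhamel, T.op_zero]

theorem IsMildSolution.sub (hT : T.HasGenerator S.gen) (hμ : μ ∈ resolventSetOf S.gen)
    (hx : IsMildSolution T B₀ μ x₀ u x) (hy : IsMildSolution T B₀ μ y₀ v y) :
    IsMildSolution T B₀ μ (x₀ - y₀) (u - v) (x - y) := by
  rw [isMildSolution_iff hT hμ] at hx hy ⊢
  refine ⟨hx.1.sub hy.1, hx.2.1.sub hy.2.1, fun t => ?_⟩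
  have := T.duhamel_sub t.coe_nonneg (B₀.intervalIntegrable_dirichlet μ hx.1 t)
    (B₀.intervalIntegrable_dirichlet μ hy.1 t)
  simp only [← map_sub] at this
  rw [Pi.sub_apply, map_sub, hx.2.2, hy.2.2, map_sub, map_sub]
  change _ = _ + T.duhamel (fun s => B₀.dirichlet μ (onReal u s - onReal v s)) t
  rw [this]
  abel

theorem IsMildSolution.shiftBy (hT : T.HasGenerator S.gen) (hμ : μ ∈ resolventSetOf S.gen)
    (hx : IsMildSolution T B₀ μ x₀ u x) (t : ℝ≥0) :
    IsMildSolution T B₀ μ (x t) (shiftBy t u) (fun h => x (t + h)) := by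
  rw [isMildSolution_iff hT hμ] at hx ⊢
  refine ⟨hx.1.shiftBy t, hx.2.1.comp (continuous_const_add t), fun h => ?_⟩
  have hI := B₀.intervalIntegrable_dirichlet μ hx.1 (t + h)
  rw [NNReal.coe_add] at hI
  have h1 : T.duhamel (fun s => B₀.dirichlet μ (onReal (_root_.shiftBy t u) s)) h =
      T.duhamel (fun s => B₀.dirichlet μ (onReal u (t + s))) h :=
    intervalIntegral.integral_congr fun s hs => by
      rw [uIcc_of_le h.coe_nonneg] at hs
      simp only [shiftBy_onReal t u hs.1]
  rw [hx.2.2, hx.2.2, NNReal.coe_add, T.duhamel_add t.coe_nonneg h.coe_nonneg hI, map_add,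
    add_comm t h, T.op_add_apply, Real.toNNReal_coe, h1, add_assoc]

theorem IsMildSolution.congr (hT : T.HasGenerator S.gen) (hμ : μ ∈ resolventSetOf S.gen)
    (hx : IsMildSolution T B₀ μ x₀ u x) (hy : IsMildSolution T B₀ μ x₀ v y) {t : ℝ≥0}
    (huv : ∀ s ≤ t, u s = v s) : x t = y t := by
  rw [isMildSolution_iff hT hμ] at hx hy
  refine resolventOp_injective hμ ?_
  rw [hx.2.2, hy.2.2]
  congr 1
  refine intervalIntegral.integral_congr fun s hs => ?_
  rw [uIcc_of_le t.coe_nonneg] at hs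
  have : onReal u s = onReal v s := huv _ (Real.toNNReal_le_iff_le_coe.2 hs.2)
  simp only [this]

theorem IsClassicalSolution.isMildSolution (hT : T.HasGenerator S.gen)
    (hμ : μ ∈ resolventSetOf S.gen) (B₀ : S.RightInverse) (hx : S.IsClassicalSolution x₀ u x) :
    IsMildSolution T B₀ μ x₀ u x := by
  obtain ⟨hu, hxc, hx0, x', hdom, hx'c, hderiv, -, heq⟩ := hx
  refine (isMildSolution_iff hT hμ).2 ⟨isLocLq_of_continuous hu, hxc, fun t => ?_⟩
  have hL : IsLocLq 1 u := isLocLq_of_continuous hu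
  have hcont : Continuous fun s : ℝ => T.op ((t : ℝ) - s).toNNReal
      (resolventOp S.gen μ (onReal x s)) :=
    T.continuous_op_uncurry.comp ((continuous_real_toNNReal.comp (by fun_prop)).prodMk
      ((resolventOp S.gen μ).continuous.comp (continuous_onReal hxc)))
  -- For a classical solution, the derivative of `s ↦ T(t-s) R x(s)` is exactly `T(t-s) K u(s)`: the
  -- terms in `𝔄 x` combine through `R (μ x - 𝔄 x) = x - K 𝔅 x`.
  have key : T.duhamel (fun s => B₀.dirichlet μ (onReal u s)) t = _ :=
    intervalIntegral.integral_eq_sub_of_hasDerivAt_of_le t.coe_nonneg hcont.continuousOn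
      (fun s hs => ?_)
      (T.intervalIntegrable_duhamel t.coe_nonneg (B₀.intervalIntegrable_dirichlet μ hL t))
  · rw [key]
    simp [onReal, hx0, T.op_zero]
  · lift s to ℝ≥0 using hs.1.le
    have hs0 : 0 < s := NNReal.coe_pos.1 hs.1
    have hd : HasDerivAt (onReal x) (x' s) s := (hderiv s).hasDerivAt (Ici_mem_nhds hs.1)
    obtain ⟨e1, e2⟩ := heq s hs0
    have e3 := resolventOp_of_opB_eq hμ B₀ ⟨x s, hdom s⟩
    rw [← e1, e2, map_sub, map_smul] at e3
    have e4 : B₀.dirichlet μ (onReal u s) = resolventOp S.gen μ (x' s) -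
        (μ • resolventOp S.gen μ (onReal x s) - onReal x s) := by
      rw [onReal_coe, onReal_coe, sub_eq_iff_eq_add.1 e3]
      abel
    beta_reduce
    rw [e4]
    exact C0Semigroup.hasDerivAt_op_sub_resolvent hT hμ hs.2 hd

/-- Classical solutions exist for all compatible data. -/
theorem exists_isClassicalSolution (hT : T.HasGenerator S.gen)
    (hμ : μ ∈ resolventSetOf S.gen) (B₀ : S.RightInverse) [CompleteSpace U]
    (h : (x₀, u) ∈ S.compatibleData) :
    ∃ x, S.IsClassicalSolution x₀ u x := by
  obtain ⟨⟨hx₀, hB⟩, hu⟩ := h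
  have huc := hu.continuous
  obtain ⟨v, w, hw, hv, hu⟩ := hu
  dsimp only at hx₀ hB huc hu
  have hvc : Continuous v := by
    rw [funext hv]
    exact continuous_const.add hw.continuous_primitive
  have hvL : IsLocLq 1 v := isLocLq_of_continuous hvc
  set R := resolventOp S.gen μ with hR
  set K := B₀.dirichlet μ with hK
  have prim : ∀ {a b : ℝ≥0 → U}, IsLocLq 1 b →
      (∀ t : ℝ≥0, a t = a 0 + ∫ s in (0 : ℝ)..t, onReal b s) → ∀ t : ℝ≥0,
      ∫ s in (0 : ℝ)..t, K (onReal b s) = K (a t) - K (a 0) := by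
    intro a b hb hab t
    rw [ContinuousLinearMap.intervalIntegral_comp_comm _ (hb.intervalIntegrable t), hab t, map_add,
      add_sub_cancel_left]
  -- Formally `W = x - K u` solves `W' = A W + μ K u - K u'`. Hence `y = W'` solves `y' = A y + g`
  -- with `g = μ K u' - K u''` and `y(0) = 𝔄 x₀ - K u'(0)`. Two weak derivatives of `u` make `g`
  -- locally integrable.
  let g : ℝ → X := fun s => μ • K (onReal v s) - K (onReal w s)
  have hvI := fun t => (B₀.intervalIntegrable_dirichlet μ hvL t)
  have hwI := fun t => (B₀.intervalIntegrable_dirichlet μ hw t)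
  have hgI : ∀ t : ℝ≥0, IntervalIntegrable g volume 0 t := fun t =>
    ((hvI t).smul μ).sub (hwI t)
  have hg : ∀ t : ℝ≥0, ∫ s in (0 : ℝ)..t, g s =
      μ • (K (u t) - K (u 0)) - (K (v t) - K (v 0)) := by
    intro t
    have := intervalIntegral.integral_sub ((hvI t).smul μ) (hwI t)
    simp only [Pi.smul_apply, intervalIntegral.integral_smul] at this
    rw [← hK, prim hvL hu, prim hw hv] at this
    exact this
  let y₀ : X := S.opA ⟨x₀, hx₀⟩ - K (v 0)
  let y : ℝ≥0 → X := fun t => T.op t y₀ + T.duhamel g t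
  have hyc : Continuous y := (T.continuous_op y₀).add
    (continuous_comp_coe_of_continuousOn_Icc fun b => T.continuousOn_duhamel b.2 (hgI b))
  -- This encodes `∫₀ᵗ y ∈ D(A)` and `A ∫₀ᵗ y = y(t) - y₀ - ∫₀ᵗ g`, the integrated form of `y' = A y
  -- + g`.
  have hyr : ∀ t : ℝ≥0, ∫ s in (0 : ℝ)..t, onReal y s =
      μ • R (∫ s in (0 : ℝ)..t, onReal y s) - R (y t - y₀ - ∫ s in (0 : ℝ)..t, g s) := by
    intro t
    let C : X →L[ℂ] X := μ • R - ContinuousLinearMap.id ℂ X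
    have hC : ∀ x, C x = μ • R x - x := fun x => by simp [C]
    have e1 : C (∫ s in (0 : ℝ)..t, onReal y s) =
        (∫ s in (0 : ℝ)..t, T.op s.toNNReal (μ • R y₀ - y₀)) +
          ∫ s in (0 : ℝ)..t, (μ • R (T.duhamel g s) - T.duhamel g s) := by
      rw [← ContinuousLinearMap.intervalIntegral_comp_comm _
        ((continuous_onReal hyc).intervalIntegrable _ _), ← intervalIntegral.integral_add
        ((T.continuous_op_toNNReal _).intervalIntegrable _ _)]
      · refine intervalIntegral.integral_congr fun s hs => ?_
        rw [uIcc_of_le t.coe_nonneg] at hs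
        simp only [onReal, y, hC, map_add, map_sub, map_smul, smul_add,
          Real.coe_toNNReal s hs.1]
        rw [hR, resolventOp_comm hT hμ]
        abel
      · have : ContinuousOn (fun s => C (T.duhamel g s)) (Icc 0 (t : ℝ)) :=
          C.continuous.comp_continuousOn (T.continuousOn_duhamel t.2 (hgI t))
        simp only [hC] at this
        refine ContinuousOn.intervalIntegrable ?_
        rwa [uIcc_of_le t.coe_nonneg]
    rw [hC, C0Semigroup.integral_op_resolvent hT hμ y₀ t.coe_nonneg,
      C0Semigroup.integral_duhamel_resolvent hT hμ t.coe_nonneg (hgI t)] at e1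
    have e2 : R (y t) = T.op t (R y₀) + R (T.duhamel g t) := by
      simp only [y, map_add]
      rw [hR, resolventOp_comm hT hμ]
    rw [map_sub, map_sub, e2]
    rw [Real.toNNReal_coe, sub_eq_iff_eq_add] at e1
    rw [e1]
    abel
  have hx₀' : R (μ • x₀ - S.opA ⟨x₀, hx₀⟩) = x₀ - K (u 0) := by
    rw [← hB]
    exact resolventOp_of_opB_eq hμ B₀ ⟨x₀, hx₀⟩
  let W : ℝ≥0 → X := fun t => x₀ - K (u 0) + ∫ s in (0 : ℝ)..t, onReal y s
  -- Equivalently, `W(t) ∈ D(A)` and `A W = y - μ K u + K u'`. The choice of `y₀` cancels the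
  -- constants, by compatibility of the data.
  have hW : ∀ t, W t = R (μ • W t - (y t - μ • K (u t) + K (v t))) := by
    intro t
    have e : μ • W t - (y t - μ • K (u t) + K (v t)) = (μ • x₀ - S.opA ⟨x₀, hx₀⟩) +
        μ • (∫ s in (0 : ℝ)..t, onReal y s) - (y t - y₀ - ∫ s in (0 : ℝ)..t, g s) := by
      simp only [W, y₀, hg, smul_add, smul_sub]
      abel
    rw [e, map_sub, map_add, hx₀', map_smul, add_sub_assoc, ← hyr t]
  let x : ℝ≥0 → X := fun t => K (u t) + W t
  have hx : ∀ t, ∃ h : x t ∈ S.opA.domain, S.opB ⟨x t, h⟩ = u t ∧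
      S.opA ⟨x t, h⟩ = K (v t) + y t := by
    intro t
    obtain ⟨h1, hB1, hA1⟩ := B₀.dirichlet_spec hμ (u t)
    obtain ⟨h2, hB2, hA2⟩ := resolventOp_spec hμ (μ • W t - (y t - μ • K (u t) + K (v t)))
    have e : x t = ((⟨_, h1⟩ + ⟨_, h2⟩ : S.opA.domain) : X) := by
      rw [Submodule.coe_add]
      exact congrArg (K (u t) + ·) (hW t)
    have e' : (⟨x t, e ▸ Subtype.mem _⟩ : S.opA.domain) = ⟨_, h1⟩ + ⟨_, h2⟩ := Subtype.ext e
    refine ⟨e ▸ Subtype.mem _, ?_, ?_⟩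
    · rw [e', map_add, hB1, hB2, add_zero]
    · rw [e', LinearPMap.map_add, hA1, hA2, ← hR, ← hW t]
      abel
  have hxint : ∀ t : ℝ≥0, x t = x₀ + ∫ s in (0 : ℝ)..t, (K (onReal v s) + onReal y s) := by
    intro t
    rw [intervalIntegral.integral_add (hvI t) ((continuous_onReal hyc).intervalIntegrable _ _),
      prim hvL hu]
    simp only [x, W]
    abel
  have hc : Continuous fun s => K (onReal v s) + onReal y s :=
    (K.continuous.comp (continuous_onReal hvc)).add (continuous_onReal hyc)
  have hxd : ∀ t : ℝ≥0, HasDerivWithinAt (onReal x) (K (v t) + y t) (Ici 0) t := by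
    intro t
    have := ((intervalIntegral.integral_hasDerivAt_right (hc.intervalIntegrable 0 (t : ℝ))
      (hc.stronglyMeasurableAtFilter _ _) hc.continuousAt).const_add x₀).hasDerivWithinAt (s := Ici 0)
    rw [onReal_coe, onReal_coe] at this
    refine this.congr_of_mem (fun s hs => ?_) t.2
    rw [onReal, hxint, Real.coe_toNNReal s hs]
  choose hdom hBx hAx using hx
  refine ⟨x, huc, ?_, ?_, fun t => K (v t) + y t, hdom,
    (K.continuous.comp hvc).add hyc, hxd, ?_, fun t _ => ⟨(hAx t).symm, hBx t⟩⟩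
  · refine continuous_iff_continuousAt.2 fun t => ?_
    have := (hxd t).continuousWithinAt.tendsto.comp (tendsto_nhdsWithin_iff.2
      ⟨NNReal.continuous_coe.tendsto t, Eventually.of_forall fun s => s.2⟩)
    simpa [Function.comp_def, ContinuousAt] using this
  · rw [hxint]
    simp
  · simp only [hAx]
    exact (K.continuous.comp hvc).add hyc

end BoundaryControlSystem


/-! ### Local `L^q` norms -/

section LqNorm

variable {E : Type*} [NormedAddCommGroup E] {q : ℝ≥0∞} {u v : ℝ≥0 → E}

theorem IsLocLq.coe_lqNorm (hu : IsLocLq q u) (t : ℝ≥0) :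
    (lqNorm q t u : ℝ≥0∞) = eLpNorm (onReal u) q (volume.restrict (Icc (0 : ℝ) t)) :=
  ENNReal.coe_toNNReal (hu t).eLpNorm_ne_top

theorem IsLocLq.lqNorm_mono (hu : IsLocLq q u) {s t : ℝ≥0} (hst : s ≤ t) :
    lqNorm q s u ≤ lqNorm q t u := by
  rw [← ENNReal.coe_le_coe, hu.coe_lqNorm, hu.coe_lqNorm]
  exact eLpNorm_mono_measure _
    (Measure.restrict_mono (Icc_subset_Icc le_rfl (NNReal.coe_le_coe.2 hst)) le_rfl)

theorem IsLocLq.lqNorm_sub_le (hq : 1 ≤ q) (hu : IsLocLq q u) (hv : IsLocLq q v) (t : ℝ≥0) :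
    lqNorm q t (u - v) ≤ lqNorm q t u + lqNorm q t v := by
  rw [← ENNReal.coe_le_coe, ENNReal.coe_add, hu.coe_lqNorm, hv.coe_lqNorm, (hu.sub hv).coe_lqNorm]
  exact eLpNorm_sub_le (hu t).aestronglyMeasurable (hv t).aestronglyMeasurable hq

/-- Hölder's inequality on an interval of finite length; what matters is that `c` does not depend on
`u`. -/
theorem exists_integral_norm_le_lqNorm (E : Type*) [NormedAddCommGroup E] (hq : 1 ≤ q) (t : ℝ≥0) :
    ∃ c : ℝ≥0, ∀ u : ℝ≥0 → E, IsLocLq q u →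
      ∫ r in (0 : ℝ)..t, ‖onReal u r‖ ≤ c * lqNorm q t u := by
  set ν := volume.restrict (Icc (0 : ℝ) t) with hν
  set a := ν univ ^ (1 / (1 : ℝ≥0∞).toReal - 1 / q.toReal) with ha
  have hqr : 1 / q.toReal ≤ 1 := by
    rcases eq_or_ne q ⊤ with rfl | hq'
    · simp
    · rw [div_le_one₀ (ENNReal.toReal_pos (zero_lt_one.trans_le hq).ne' hq')]
      exact (ENNReal.toReal_le_toReal ENNReal.one_ne_top hq').2 hq
  have hatop : a ≠ ⊤ := ENNReal.rpow_ne_top_of_nonneg (by simpa using hqr) (measure_ne_top ν _)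
  refine ⟨a.toNNReal, fun u hu => ?_⟩
  have h1 := eLpNorm_le_eLpNorm_mul_rpow_measure_univ hq (hu t).aestronglyMeasurable
  have h2 : ∫ r in (0 : ℝ)..t, ‖onReal u r‖ = (eLpNorm (onReal u) 1 ν).toReal := by
    rw [intervalIntegral.integral_of_le t.coe_nonneg, ← integral_Icc_eq_integral_Ioc,
      eLpNorm_one_eq_lintegral_enorm, integral_norm_eq_lintegral_enorm (hu t).aestronglyMeasurable]
  rw [h2]
  refine ENNReal.toReal_le_of_le_ofReal (by positivity) (h1.trans_eq ?_)
  rw [← NNReal.coe_mul, ENNReal.ofReal_coe_nnreal, ENNReal.coe_mul, hu.coe_lqNorm,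
    ENNReal.coe_toNNReal hatop, mul_comm]

end LqNorm

theorem IsClassKL.le_apply_zero {β : ℝ≥0 → ℝ≥0 → ℝ≥0} (hβ : IsClassKL β) (r t : ℝ≥0) :
    β r t ≤ β r 0 := by
  rcases eq_zero_or_pos r with rfl | hr
  · exact ((hβ.classK t).map_zero.trans (hβ.classK 0).map_zero.symm).le
  · exact (hβ.classL r hr).strictAnti.antitone zero_le

/-! ### ISS estimates and passage to the limit -/

namespace BoundaryControlSystem

variable {X U : Type*} [NormedAddCommGroup X] [NormedSpace ℂ X]
  [NormedAddCommGroup U] [NormedSpace ℂ U] {S : BoundaryControlSystem X U}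

/-- Mild solutions exist for all data in `D`, and they satisfy an `L^q`-ISS estimate. -/
def MildEstimate (T : C0Semigroup X) (B₀ : S.RightInverse) (μ : ℂ) (D : Set (X × (ℝ≥0 → U)))
    (q : ℝ≥0∞) : Prop :=
  ∃ (β : ℝ≥0 → ℝ≥0 → ℝ≥0) (γ : ℝ≥0 → ℝ≥0), IsClassKL β ∧ IsClassK γ ∧
    ∀ p ∈ D, ∃ x, IsMildSolution T B₀ μ p.1 p.2 x ∧
      ∀ t, 0 < t → ‖x t‖₊ ≤ β ‖p.1‖₊ t + γ (lqNorm q t p.2)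

variable {T : C0Semigroup X} {B₀ : S.RightInverse} {μ : ℂ} {D D' : Set (X × (ℝ≥0 → U))}
  {q : ℝ≥0∞}

theorem MildEstimate.mono (h : MildEstimate T B₀ μ D q) (hD : D' ⊆ D) :
    MildEstimate T B₀ μ D' q := by
  obtain ⟨β, γ, hβ, hγ, h⟩ := h
  exact ⟨β, γ, hβ, hγ, fun p hp => h p (hD hp)⟩

variable [CompleteSpace X]

/-- A mild solution with an ISS estimate is obtained as a limit of such solutions. -/
theorem exists_isMildSolution_of_approx (hT : T.HasGenerator S.gen)
    (hμ : μ ∈ resolventSetOf S.gen) {β : ℝ≥0 → ℝ≥0 → ℝ≥0} {γ : ℝ≥0 → ℝ≥0} (hβ : IsClassKL β)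
    (hγ : IsClassK γ) (hq : 1 ≤ q) (hsub : ∀ p ∈ D, ∀ p' ∈ D, p - p' ∈ D)
    (hDq : ∀ p ∈ D, IsLocLq q p.2)
    (hD : ∀ p ∈ D, ∃ x, IsMildSolution T B₀ μ p.1 p.2 x ∧
      ∀ t, 0 < t → ‖x t‖₊ ≤ β ‖p.1‖₊ t + γ (lqNorm q t p.2))
    {x₀ : X} {u : ℝ≥0 → U} (hu : IsLocLq q u)
    (happ : ∀ t ε : ℝ≥0, 0 < ε → ∃ p ∈ D, ‖p.1 - x₀‖₊ ≤ ε ∧ lqNorm q t (p.2 - u) ≤ ε) :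
    ∃ x, IsMildSolution T B₀ μ x₀ u x ∧
      ∀ t, 0 < t → ‖x t‖₊ ≤ β ‖x₀‖₊ t + γ (lqNorm q t u) := by
  let e : ℕ → ℝ≥0 := fun n => 1 / ((n : ℝ≥0) + 1)
  have he0 : Tendsto e atTop (𝓝 0) := tendsto_one_div_add_atTop_nhds_zero_nat
  have hea : Antitone e := fun m n hmn => by
    simp only [e]
    gcongr
  -- The `n`-th datum is within `1 / (n + 1)` of the target on `[0, n]`, so every bounded time
  -- interval is eventually covered.
  choose p hpD hp1 hp2 using fun n : ℕ => happ n (e n) (by simp only [e]; positivity)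
  choose x hx hxe using fun n => hD (p n) (hpD n)
  have hpu : ∀ n : ℕ, ∀ t : ℝ≥0, t ≤ n → lqNorm q t ((p n).2 - u) ≤ e n := fun n t ht =>
    (((hDq _ (hpD n)).sub hu).lqNorm_mono ht).trans (hp2 n)
  -- Bound for differences of solutions from index `n` on: two data differ by at most `2 * e n`. The
  -- last summand covers time `0`, where the ISS estimate is not available.
  let b : ℕ → ℝ≥0 := fun n => β (2 * e n) 0 + γ (2 * e n) + 2 * e n
  have hb : Tendsto b atTop (𝓝 0) := by
    have h2 : Tendsto (fun n => 2 * e n) atTop (𝓝 0) := by simpa using he0.const_mul 2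
    have h3 := (((hβ.classK 0).continuous.tendsto 0).comp h2).add
      ((hγ.continuous.tendsto 0).comp h2) |>.add h2
    simpa [(hβ.classK 0).map_zero, hγ.map_zero] using h3
  have hdist : ∀ N m n : ℕ, N ≤ m → N ≤ n → ∀ s : ℝ≥0, s ≤ N → dist (x m s) (x n s) ≤ b N := by
    intro N m n hm hn s hs
    have h1 : ‖(p m).1 - (p n).1‖₊ ≤ 2 * e N := by
      have : (p m).1 - (p n).1 = ((p m).1 - x₀) - ((p n).1 - x₀) := by abel
      rw [this, two_mul]
      exact (nnnorm_sub_le _ _).trans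
        (add_le_add ((hp1 m).trans (hea hm)) ((hp1 n).trans (hea hn)))
    have h2 : lqNorm q s ((p m).2 - (p n).2) ≤ 2 * e N := by
      have : (p m).2 - (p n).2 = ((p m).2 - u) - ((p n).2 - u) := by abel
      rw [this, two_mul]
      exact (IsLocLq.lqNorm_sub_le hq ((hDq _ (hpD m)).sub hu) ((hDq _ (hpD n)).sub hu) s).trans
        (add_le_add ((hpu m s (hs.trans (by exact_mod_cast hm))).trans (hea hm))
          ((hpu n s (hs.trans (by exact_mod_cast hn))).trans (hea hn)))
    rw [dist_eq_norm, ← coe_nnnorm, NNReal.coe_le_coe]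
    obtain ⟨z, hz, hze⟩ := hD _ (hsub _ (hpD m) _ (hpD n))
    have hzx : z = x m - x n := hz.unique hT hμ ((hx m).sub hT hμ (hx n))
    rcases eq_zero_or_pos s with rfl | hs0
    · rw [(hx m).apply_zero hT hμ, (hx n).apply_zero hT hμ]
      exact h1.trans le_add_self
    · rw [← Pi.sub_apply, ← hzx]
      refine (hze s hs0).trans (le_add_right (add_le_add ?_ (hγ.strictMono.monotone h2)))
      exact (hβ.le_apply_zero _ _).trans ((hβ.classK 0).strictMono.monotone h1)
  have hlim : ∀ s, ∃ y, Tendsto (fun n => x n s) atTop (𝓝 y) := by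
    intro s
    refine cauchySeq_tendsto_of_complete (Metric.cauchySeq_iff.2 fun ε hε => ?_)
    have h1 : ∀ᶠ N in atTop, (b N : ℝ) < ε :=
      ((NNReal.continuous_coe.tendsto 0).comp hb).eventually (gt_mem_nhds hε)
    obtain ⟨N, hN, hsN⟩ := (h1.and (tendsto_natCast_atTop_atTop.eventually_ge_atTop s)).exists
    exact ⟨N, fun m hm n hn => (hdist N m n hm hn s hsN).trans_lt hN⟩
  choose y hy using hlim
  have hunif : ∀ N n : ℕ, N ≤ n → ∀ s : ℝ≥0, s ≤ N → dist (y s) (x n s) ≤ b N := by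
    intro N n hn s hs
    refine le_of_tendsto ((hy s).dist tendsto_const_nhds) ?_
    filter_upwards [eventually_ge_atTop N] with m hm
    exact hdist N m n hm hn s hs
  have hyc : Continuous y := by
    refine TendstoLocallyUniformly.continuous (F := x) (p := atTop)
      (Metric.tendstoLocallyUniformly_iff.2 fun ε hε s => ?_)
      (Eventually.of_forall fun n => (hx n).2.1).frequently
    have h1 : ∀ᶠ N in atTop, (b N : ℝ) < ε :=
      ((NNReal.continuous_coe.tendsto 0).comp hb).eventually (gt_mem_nhds hε)
    obtain ⟨N, hN, hsN⟩ :=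
      (h1.and (tendsto_natCast_atTop_atTop.eventually_ge_atTop (s + 1))).exists
    refine ⟨Iio (s + 1), Iio_mem_nhds (by simp), ?_⟩
    filter_upwards [eventually_ge_atTop N] with n hn r hr
    exact (hunif N n hn r ((mem_Iio.1 hr).le.trans hsN)).trans_lt hN
  refine ⟨y, (isMildSolution_iff hT hμ).2 ⟨hu.isLocLq_one hq, hyc, fun t => ?_⟩, fun t ht => ?_⟩
  · refine tendsto_nhds_unique (((resolventOp S.gen μ).continuous.tendsto _).comp (hy t)) ?_
    have hpx : Tendsto (fun n => (p n).1) atTop (𝓝 x₀) :=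
      tendsto_iff_norm_sub_tendsto_zero.2 (squeeze_zero (fun _ => norm_nonneg _)
        (fun n => by exact_mod_cast hp1 n) ((NNReal.continuous_coe.tendsto 0).comp he0))
    have h1 : Tendsto (fun n => T.op t (resolventOp S.gen μ (p n).1)) atTop
        (𝓝 (T.op t (resolventOp S.gen μ x₀))) :=
      ((T.op t).continuous.comp (resolventOp S.gen μ).continuous).tendsto _ |>.comp hpx
    have h2 : Tendsto (fun n => T.duhamel (fun s => B₀.dirichlet μ (onReal (p n).2 s)) t) atTop
        (𝓝 (T.duhamel (fun s => B₀.dirichlet μ (onReal u s)) t)) := by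
      -- In the equation in `X` the input enters through the bounded operator `K`, so `L¹`
      -- convergence on `[0, t]` suffices, and `L^q` convergence gives it.
      obtain ⟨M, hM0, hM⟩ := T.exists_norm_duhamel_le t
      obtain ⟨c, hc⟩ := exists_integral_norm_le_lqNorm U hq t
      set K := B₀.dirichlet μ with hK
      refine tendsto_iff_norm_sub_tendsto_zero.2 (squeeze_zero' (Eventually.of_forall fun _ =>
        norm_nonneg _) (g := fun n => M * (‖K‖ * (c * e n))) ?_ ?_)
      · filter_upwards [tendsto_natCast_atTop_atTop.eventually_ge_atTop t] with n hn
        have hL := (hDq _ (hpD n)).sub hu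
        have hI := B₀.intervalIntegrable_dirichlet μ ((hDq _ (hpD n)).isLocLq_one hq) t
        have hIu := B₀.intervalIntegrable_dirichlet μ (hu.isLocLq_one hq) t
        rw [← T.duhamel_sub t.coe_nonneg hI hIu]
        refine (hM _ t t.coe_nonneg le_rfl (hI.sub hIu)).trans
          (mul_le_mul_of_nonneg_left ?_ hM0)
        calc ∫ r in (0 : ℝ)..t, ‖K (onReal (p n).2 r) - K (onReal u r)‖
            ≤ ∫ r in (0 : ℝ)..t, ‖K‖ * ‖onReal ((p n).2 - u) r‖ := by
              refine intervalIntegral.integral_mono_on t.coe_nonneg (hI.sub hIu).norm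
                (((hL.isLocLq_one hq).intervalIntegrable t).norm.const_mul _) fun r _ => ?_
              rw [← map_sub]
              exact K.le_opNorm _
          _ ≤ ‖K‖ * (c * e n) := by
              rw [intervalIntegral.integral_const_mul]
              refine mul_le_mul_of_nonneg_left ((hc _ hL).trans ?_) (norm_nonneg _)
              exact_mod_cast mul_le_mul_of_nonneg_left (hpu n t hn) (zero_le (a := c))
      · have := (NNReal.continuous_coe.tendsto 0).comp he0
        simpa using ((this.const_mul (c : ℝ)).const_mul ‖K‖).const_mul M
    refine (h1.add h2).congr fun n => ?_
    exact (((isMildSolution_iff hT hμ).1 (hx n)).2.2 t).symm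
  · have h1 : ∀ r : ℝ≥0, Tendsto (fun n => r + e n) atTop (𝓝 r) := fun r => by
      simpa using he0.const_add r
    refine le_of_tendsto_of_tendsto (hy t).nnnorm
      ((((hβ.classK t).continuous.tendsto _).comp (h1 ‖x₀‖₊)).add
        ((hγ.continuous.tendsto _).comp (h1 (lqNorm q t u)))) ?_
    filter_upwards [tendsto_natCast_atTop_atTop.eventually_ge_atTop t] with n hn
    refine (hxe n t ht).trans (add_le_add ((hβ.classK t).strictMono.monotone ?_)
      (hγ.strictMono.monotone ?_))
    · calc ‖(p n).1‖₊ = ‖x₀ + ((p n).1 - x₀)‖₊ := by rw [add_sub_cancel]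
        _ ≤ ‖x₀‖₊ + e n := (nnnorm_add_le _ _).trans (add_le_add le_rfl (hp1 n))
    · have h0 : IsLocLq q ((u - (p n).2)) := hu.sub (hDq _ (hpD n))
      calc lqNorm q t (p n).2 = lqNorm q t (u - (u - (p n).2)) := by rw [sub_sub_cancel]
        _ ≤ lqNorm q t u + lqNorm q t (u - (p n).2) := hu.lqNorm_sub_le hq h0 t
        _ ≤ lqNorm q t u + e n := by
          have : lqNorm q t (u - (p n).2) = lqNorm q t ((p n).2 - u) := by
            rw [lqNorm, lqNorm]
            exact congrArg ENNReal.toNNReal (eLpNorm_sub_comm (onReal u) (onReal (p n).2) _ _)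
          rw [this]
          exact add_le_add le_rfl (hpu n t hn)

theorem MildEstimate.of_approx (hT : T.HasGenerator S.gen)
    (hμ : μ ∈ resolventSetOf S.gen) (hq : 1 ≤ q) (hsub : ∀ p ∈ D, ∀ p' ∈ D, p - p' ∈ D)
    (hDq : ∀ p ∈ D, IsLocLq q p.2) (h : MildEstimate T B₀ μ D q)
    (hDq' : ∀ p ∈ D', IsLocLq q p.2)
    (happ : ∀ p' ∈ D', ∀ t ε : ℝ≥0, 0 < ε →
      ∃ p ∈ D, ‖p.1 - p'.1‖₊ ≤ ε ∧ lqNorm q t (p.2 - p'.2) ≤ ε) :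
    MildEstimate T B₀ μ D' q := by
  obtain ⟨β, γ, hβ, hγ, h⟩ := h
  exact ⟨β, γ, hβ, hγ, fun p' hp' =>
    exists_isMildSolution_of_approx hT hμ hβ hγ hq hsub hDq h (hDq' p' hp') (happ p' hp')⟩

end BoundaryControlSystem


/-- A smooth function that vanishes on `(-∞, δ/2]`, equals `1` on `[δ, ∞)`, and takes values in
`[0, 1]`. -/
theorem exists_smooth_cutoff {δ : ℝ} (hδ : 0 < δ) : ∃ χ : ℝ → ℝ,
    ContDiff ℝ ((⊤ : ℕ∞) : WithTop ℕ∞) χ ∧ (∀ r ≤ δ / 2, χ r = 0) ∧ (∀ r, δ ≤ r → χ r = 1) ∧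
      ∀ r, 0 ≤ χ r ∧ χ r ≤ 1 := by
  refine ⟨fun r => Real.smoothTransition (2 * r / δ - 1), ?_, fun r hr => ?_, fun r hr => ?_,
    fun r => ⟨Real.smoothTransition.nonneg _, Real.smoothTransition.le_one _⟩⟩
  · exact Real.smoothTransition.contDiff.comp (by fun_prop)
  · refine Real.smoothTransition.zero_of_nonpos ?_
    rw [sub_nonpos, div_le_one₀ hδ]
    linarith
  · refine Real.smoothTransition.one_of_one_le ?_
    rw [le_sub_iff_add_le, le_div_iff₀ hδ]
    linarith

theorem lqNorm_le {E : Type*} [NormedAddCommGroup E] {q : ℝ≥0∞} {u : ℝ≥0 → E} {t ε : ℝ≥0}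
    (h : eLpNorm (onReal u) q (volume.restrict (Icc (0 : ℝ) t)) ≤ ε) : lqNorm q t u ≤ ε :=
  (ENNReal.toNNReal_mono ENNReal.coe_ne_top h).trans_eq (ENNReal.toNNReal_coe _)

theorem lqNorm_top_le {E : Type*} [NormedAddCommGroup E] {u : ℝ≥0 → E} {t ε : ℝ≥0} (hu : ∀ s ≤ t, ‖u s‖₊ ≤ ε) :
    lqNorm ⊤ t u ≤ ε := by
  refine lqNorm_le ?_
  rw [eLpNorm_exponent_top, ← ENNReal.ofReal_coe_nnreal]
  refine eLpNormEssSup_le_of_ae_bound ?_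
  filter_upwards [ae_restrict_mem measurableSet_Icc] with s hs
  exact_mod_cast hu s.toNNReal (Real.toNNReal_le_iff_le_coe.2 hs.2)

/-! ### Density of smooth inputs -/

section Density

variable {E : Type*} [NormedAddCommGroup E] [NormedSpace ℂ E]

/-- Test inputs are dense in `L^q(0, t)` for `q < ∞`. -/
theorem exists_isTestInput_lqNorm_sub_le {q : ℝ≥0∞} (hq : 1 ≤ q) (hq' : q ≠ ⊤) {u : ℝ≥0 → E}
    (hu : IsLocLq q u) (t : ℝ≥0) {ε : ℝ≥0} (hε : 0 < ε) :
    ∃ v, IsTestInput v ∧ lqNorm q t (v - u) ≤ ε := by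
  set f : ℝ → E := (Icc (0 : ℝ) t).indicator (onReal u) with hf
  have hfL : MemLp f q volume := (memLp_indicator_iff_restrict measurableSet_Icc).2 (hu t)
  have hε2 : (0 : ℝ) < ε / 2 := half_pos hε
  -- Absolute continuity of the norm, valid for `q < ∞`, makes `f` small on `[0, δ]`, so cutting off
  -- near `0` is cheap. With `g` smooth and close to `f`, the error splits as `χ g - f = χ (g - f) +
  -- (χ - 1) f`, each part at most `ε / 2`.
  obtain ⟨δ, hδ, hδf⟩ := hfL.eLpNorm_indicator_le hq hq' hε2
  have hδf := hδf (Icc 0 δ) measurableSet_Icc (by simp)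
  obtain ⟨g, hgc, hg, hfg⟩ := hfL.exist_eLpNorm_sub_le hq' hq hε2
  obtain ⟨χ, hχ, hχ0, hχ1, hχI⟩ := exists_smooth_cutoff hδ
  refine ⟨fun r => χ r • g r, ⟨fun r => χ r • g r, hχ.smul hg, hgc.smul_left, ?_, fun _ => rfl⟩, ?_⟩
  · have hsub : tsupport (fun r => χ r • g r) ⊆ Ici (δ / 2) := by
      refine closure_minimal (fun r hr => ?_) isClosed_Ici
      by_contra hlt
      exact hr (by simp [hχ0 r (not_le.1 hlt).le])
    exact hsub.trans (Ici_subset_Ioi.2 (by positivity))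
  · refine lqNorm_le ?_
    have h1 : eLpNorm (onReal ((fun r : ℝ≥0 => χ r • g r) - u)) q
        (volume.restrict (Icc (0 : ℝ) t)) ≤
        eLpNorm (fun r => χ r • (g - f) r + (χ r - 1) • f r) q volume := by
      rw [← eLpNorm_indicator_eq_eLpNorm_restrict measurableSet_Icc]
      refine eLpNorm_mono fun r => ?_
      by_cases hr : r ∈ Icc (0 : ℝ) t
      · rw [indicator_of_mem hr]
        have : f r = onReal u r := indicator_of_mem hr _
        rw [Pi.sub_apply, this]
        simp only [onReal, Pi.sub_apply, Real.coe_toNNReal r hr.1]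
        refine (congrArg norm ?_).le
        module
      · rw [indicator_of_notMem hr]
        simp
    have hgL : AEStronglyMeasurable (g - f) volume :=
      hg.continuous.aestronglyMeasurable.sub hfL.aestronglyMeasurable
    have h2 : eLpNorm (fun r => χ r • (g - f) r) q volume ≤ ENNReal.ofReal (ε / 2) := by
      rw [eLpNorm_sub_comm] at hfg
      refine (eLpNorm_mono fun r => ?_).trans hfg
      rw [norm_smul, Real.norm_of_nonneg (hχI r).1]
      exact mul_le_of_le_one_left (norm_nonneg _) (hχI r).2
    have h3 : eLpNorm (fun r => (χ r - 1) • f r) q volume ≤ ENNReal.ofReal (ε / 2) := by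
      refine (eLpNorm_mono fun r => ?_).trans hδf
      by_cases hr : r ∈ Icc 0 δ
      · rw [indicator_of_mem hr, norm_smul]
        refine mul_le_of_le_one_left (norm_nonneg _) ?_
        rw [Real.norm_eq_abs, abs_le]
        constructor <;> linarith [(hχI r).1, (hχI r).2]
      · rw [indicator_of_notMem hr, norm_zero, norm_le_zero_iff]
        by_cases hr' : r ∈ Icc (0 : ℝ) t
        · have : δ ≤ r := by
            by_contra hlt
            exact hr ⟨hr'.1, (not_le.1 hlt).le⟩
          rw [hχ1 r this, sub_self, zero_smul]
        · rw [hf, indicator_of_notMem hr', smul_zero]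
    refine h1.trans ((eLpNorm_add_le (hχ.continuous.aestronglyMeasurable.smul hgL)
      ((hχ.continuous.sub continuous_const).aestronglyMeasurable.smul hfL.aestronglyMeasurable)
      hq).trans ((add_le_add h2 h3).trans_eq ?_))
    rw [← ENNReal.ofReal_add hε2.le hε2.le, add_halves, ENNReal.ofReal_coe_nnreal]

/-- Smooth inputs are dense in `C([0, t])`. -/
theorem exists_contDiff_norm_sub_le [CompleteSpace E] {u : ℝ≥0 → E} (hu : Continuous u) (t : ℝ≥0) {ε : ℝ≥0}
    (hε : 0 < ε) : ∃ φ : ℝ → E, ContDiff ℝ 2 φ ∧ ∀ s ≤ t, ‖φ s - u s‖₊ ≤ ε := by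
  have h := (mem_closure_iff_nhds_basis (nhds_basis_uniformity
    Metric.uniformity_basis_dist.compactConvergenceUniformity)).1
    (ContinuousMap.dense_setOfPred_contDiff (E := ℝ) (F := E) ⟨onReal u, continuous_onReal hu⟩)
    (Icc (0 : ℝ) t, (ε : ℝ)) ⟨isCompact_Icc, hε⟩
  obtain ⟨φ, hφ, h⟩ := h
  refine ⟨φ, contDiff_infty.1 hφ 2, fun s hs => ?_⟩
  have : dist (φ s) (onReal u s) < ε := h s ⟨s.2, hs⟩
  rw [ onReal_coe, dist_eq_norm] at this
  exact_mod_cast this.le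

end Density

/-! ### Density of the data sets -/

namespace BoundaryControlSystem

variable {X U : Type*} [NormedAddCommGroup X] [NormedSpace ℂ X]
  [NormedAddCommGroup U] [NormedSpace ℂ U] {S : BoundaryControlSystem X U}
  {T : C0Semigroup X} {B₀ : S.RightInverse} {μ : ℂ} {D : Set (X × (ℝ≥0 → U))}
  {q : ℝ≥0∞}

theorem sub_mem_testData {p p' : X × (ℝ≥0 → U)} (hp : p ∈ S.testData) (hp' : p' ∈ S.testData) :
    p - p' ∈ S.testData :=
  ⟨S.gen.domain.sub_mem hp.1 hp'.1, hp.2.sub hp'.2⟩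

theorem sub_mem_compatibleData [CompleteSpace U] {p p' : X × (ℝ≥0 → U)}
    (hp : p ∈ S.compatibleData) (hp' : p' ∈ S.compatibleData) : p - p' ∈ S.compatibleData := by
  obtain ⟨⟨h, hB⟩, hu⟩ := hp
  obtain ⟨⟨h', hB'⟩, hu'⟩ := hp'
  refine ⟨⟨S.opA.domain.sub_mem h h', ?_⟩, hu.sub hu'⟩
  have : S.opB (⟨p.1, h⟩ - ⟨p'.1, h'⟩) = p.2 0 - p'.2 0 := by rw [map_sub, hB, hB']
  exact this

theorem testData_subset_compatibleData [CompleteSpace U] : S.testData ⊆ S.compatibleData := by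
  rintro ⟨x, u⟩ ⟨hx, hu⟩
  obtain ⟨h, hB⟩ := mem_gen_domain.1 hx
  exact ⟨⟨h, hB.trans hu.apply_zero.symm⟩, hu.isW21Loc⟩

theorem isLocLq_of_mem_compatibleData {p : X × (ℝ≥0 → U)} (hp : p ∈ S.compatibleData) :
    IsLocLq q p.2 :=
  isLocLq_of_continuous hp.2.continuous

theorem MildEstimate.exists_solution (h : MildEstimate T B₀ μ D q) :
    ∀ p ∈ D, ∃ x, IsMildSolution T B₀ μ p.1 p.2 x := by
  obtain ⟨β, γ, -, -, h⟩ := h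
  exact fun p hp => (h p hp).imp fun _ => And.left

theorem mildEstimate_of_isISS {Sol : X → (ℝ≥0 → U) → (ℝ≥0 → X) → Prop} {F : ControlFlow X U}
    (hF : F.IsDefinedBy Sol) (hSol : ∀ x₀ u x, Sol x₀ u x → IsMildSolution T B₀ μ x₀ u x)
    (hq : ∀ p ∈ F.data, IsLocLq q p.2) (h : F.IsISS q) : MildEstimate T B₀ μ F.data q := by
  obtain ⟨β, γ, hβ, hγ, h⟩ := h
  exact ⟨β, γ, hβ, hγ, fun p hp => ⟨_, hSol _ _ _ ((hF _ _ hp _).2 rfl),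
    fun t ht => h t _ _ ht hp (hq p hp)⟩⟩

variable [CompleteSpace X]

theorem exists_mem_testData_approx [CompleteSpace U] (hT : T.HasGenerator S.gen) (hq : 1 ≤ q)
    (hq' : q ≠ ⊤) {u : ℝ≥0 → U} (hu : IsLocLq q u) (x₀ : X) (t : ℝ≥0) {ε : ℝ≥0} (hε : 0 < ε) :
    ∃ p ∈ S.testData, ‖p.1 - x₀‖₊ ≤ ε ∧ lqNorm q t (p.2 - u) ≤ ε := by
  obtain ⟨v, hv, hvu⟩ := exists_isTestInput_lqNorm_sub_le hq hq' hu t hε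
  obtain ⟨x, hx, hxd⟩ := (dense_domain hT).exists_dist_lt x₀ (ε := (ε : ℝ)) hε
  rw [dist_comm, dist_eq_norm] at hxd
  exact ⟨(x, v), ⟨hx, hv⟩, by exact_mod_cast hxd.le, hvu⟩

theorem exists_mem_compatibleData_approx [CompleteSpace U] (hT : T.HasGenerator S.gen)
    (hμ : μ ∈ resolventSetOf S.gen) (B₀ : S.RightInverse) {u : ℝ≥0 → U} (hu : Continuous u)
    (x₀ : X) (t : ℝ≥0) {ε : ℝ≥0} (hε : 0 < ε) :
    ∃ p ∈ S.compatibleData, ‖p.1 - x₀‖₊ ≤ ε ∧ lqNorm ⊤ t (p.2 - u) ≤ ε := by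
  set K := B₀.dirichlet μ with hK
  have hk : 0 < 1 + ‖K‖₊ := by positivity
  -- Uniform accuracy for the input: it keeps `K (φ 0 - u 0)` below `ε / 2`, and the summand `1`
  -- excludes division by zero.
  have hη : 0 < ε / 2 / (1 + ‖K‖₊) := by positivity
  have hη' : ε / 2 / (1 + ‖K‖₊) ≤ ε / 2 := div_le_self zero_le le_self_add
  have hηK : ‖K‖₊ * (ε / 2 / (1 + ‖K‖₊)) ≤ ε / 2 := by
    rw [mul_div_assoc', div_le_iff₀ hk, mul_comm]
    exact mul_le_mul_of_nonneg_left le_add_self zero_le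
  obtain ⟨φ, hφ, hφu⟩ := exists_contDiff_norm_sub_le hu t hη
  obtain ⟨d, hd, hdd⟩ := (dense_domain hT).exists_dist_lt (x₀ - K (u 0)) (ε := (ε / 2 : ℝ))
    (half_pos hε)
  rw [dist_comm, dist_eq_norm] at hdd
  obtain ⟨hd1, hd2⟩ := mem_gen_domain.1 hd
  obtain ⟨h1, h2, -⟩ := B₀.dirichlet_spec hμ (φ 0)
  -- The term `K (φ 0)` enforces compatibility with the perturbed input, since `d ∈ ker 𝔅`; `d`
  -- approximates `x₀ - K (u 0)`, so the sum is close to `x₀`.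
  refine ⟨(d + K (φ 0), fun s => φ s), ⟨⟨S.opA.domain.add_mem hd1 h1, ?_⟩,
    isW21Loc_of_contDiff hφ⟩, ?_, lqNorm_top_le fun s hs => ?_⟩
  · have : S.opB (⟨d, hd1⟩ + ⟨_, h1⟩) = φ 0 := by rw [map_add, hd2, h2, zero_add]
    exact this
  · have e : d + K (φ 0) - x₀ = (d - (x₀ - K (u 0))) + K (φ 0 - u 0) := by
      rw [map_sub]
      abel
    have h3 : ‖d - (x₀ - K (u 0))‖₊ ≤ ε / 2 := by exact_mod_cast hdd.le
    have h4 : ‖K (φ 0 - u 0)‖₊ ≤ ε / 2 := by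
      refine (K.le_opNNNorm _).trans (le_trans ?_ hηK)
      exact mul_le_mul_of_nonneg_left (by simpa using hφu 0 zero_le) zero_le
    rw [e, ← add_halves ε]
    exact (nnnorm_add_le _ _).trans (add_le_add h3 h4)
  · exact (hφu s hs).trans (hη'.trans (half_le_self zero_le))

/-! ### Flows of mild and classical solutions -/

open Classical in
/-- The value at time `t` of the mild solution, `0` if there is none. -/
def mildFlow (T : C0Semigroup X) (B₀ : S.RightInverse) (μ : ℂ) (t : ℝ≥0) (x₀ : X)
    (u : ℝ≥0 → U) : X :=
  if h : ∃ x, IsMildSolution T B₀ μ x₀ u x then h.choose t else 0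

theorem IsMildSolution.eq_mildFlow (hT : T.HasGenerator S.gen) (hμ : μ ∈ resolventSetOf S.gen)
    {x₀ : X} {u : ℝ≥0 → U} {x : ℝ≥0 → X} (hx : IsMildSolution T B₀ μ x₀ u x) :
    x = fun t => mildFlow T B₀ μ t x₀ u := by
  have h : ∃ x, IsMildSolution T B₀ μ x₀ u x := ⟨x, hx⟩
  simp only [mildFlow, dif_pos h]
  exact hx.unique hT hμ h.choose_spec

theorem isMildSolution_mildFlow (hT : T.HasGenerator S.gen) (hμ : μ ∈ resolventSetOf S.gen)
    {x₀ : X} {u : ℝ≥0 → U} (h : ∃ x, IsMildSolution T B₀ μ x₀ u x) :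
    IsMildSolution T B₀ μ x₀ u fun t => mildFlow T B₀ μ t x₀ u := by
  obtain ⟨x, hx⟩ := h
  rwa [← hx.eq_mildFlow hT hμ]

/-- The flow of mild solutions on a set of data for which they exist. -/
def mildControlFlow (hT : T.HasGenerator S.gen) (hμ : μ ∈ resolventSetOf S.gen)
    (B₀ : S.RightInverse) (D : Set (X × (ℝ≥0 → U)))
    (hD : ∀ p ∈ D, ∃ x, IsMildSolution T B₀ μ p.1 p.2 x) : ControlFlow X U where
  data := D
  flow := mildFlow T B₀ μ
  flow_zero x u h := (isMildSolution_mildFlow hT hμ (hD _ h)).apply_zero hT hμ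
  flow_add t h x u hxu h' := by
    have h1 := (isMildSolution_mildFlow hT hμ (hD _ hxu)).shiftBy hT hμ t
    exact congrFun (h1.unique hT hμ (isMildSolution_mildFlow hT hμ (hD _ h'))) h
  causal t x u u' h h' huu' := by
    have h1 := isMildSolution_mildFlow hT hμ (hD _ h)
    have h2 := isMildSolution_mildFlow hT hμ (hD _ h')
    exact h1.congr hT hμ h2 huu'

theorem MildEstimate.isISS (hT : T.HasGenerator S.gen) (hμ : μ ∈ resolventSetOf S.gen)
    (h : MildEstimate T B₀ μ D q) : (mildControlFlow hT hμ B₀ D h.exists_solution).IsISS q := by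
  obtain ⟨β, γ, hβ, hγ, h⟩ := h
  refine ⟨β, γ, hβ, hγ, fun t x u ht hxu _ => ?_⟩
  obtain ⟨y, hy, hye⟩ := h _ hxu
  have := hye t ht
  rw [hy.eq_mildFlow hT hμ] at this
  exact this

/-- A classical solution exists and is mild, and mild solutions are unique; hence the mild flow is
also the flow of classical solutions. -/
theorem isDefinedBy_isClassicalSolution [CompleteSpace U] (hT : T.HasGenerator S.gen)
    (hμ : μ ∈ resolventSetOf S.gen) {D : Set (X × (ℝ≥0 → U))} (hDc : D ⊆ S.compatibleData)
    (hD : ∀ p ∈ D, ∃ x, IsMildSolution T B₀ μ p.1 p.2 x) :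
    (mildControlFlow hT hμ B₀ D hD).IsDefinedBy S.IsClassicalSolution := by
  intro x₀ u hxu x
  have key : ∀ y, S.IsClassicalSolution x₀ u y → y = fun t => mildFlow T B₀ μ t x₀ u := fun y hy =>
    (hy.isMildSolution hT hμ B₀).eq_mildFlow hT hμ
  refine ⟨key x, fun hx => ?_⟩
  obtain ⟨y, hy⟩ := exists_isClassicalSolution hT hμ B₀ (hDc hxu)
  rw [hx]
  exact key y hy ▸ hy

theorem classicalTestISS_iff [CompleteSpace U] (hT : T.HasGenerator S.gen)
    (hμ : μ ∈ resolventSetOf S.gen) (B₀ : S.RightInverse) :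
    S.ClassicalTestISS q ↔ MildEstimate T B₀ μ S.testData q := by
  constructor
  · rintro ⟨F, hd, hF, h⟩
    rw [← hd]
    refine mildEstimate_of_isISS hF (fun _ _ _ hx => hx.isMildSolution hT hμ B₀) (fun p hp => ?_) h
    rw [hd] at hp
    exact isLocLq_of_mem_compatibleData (testData_subset_compatibleData hp)
  · intro h
    exact ⟨_, rfl, isDefinedBy_isClassicalSolution hT hμ testData_subset_compatibleData
      h.exists_solution, h.isISS hT hμ⟩

theorem classicalCompatibleISS_iff [CompleteSpace U] (hT : T.HasGenerator S.gen)
    (hμ : μ ∈ resolventSetOf S.gen) (B₀ : S.RightInverse) :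
    S.ClassicalCompatibleISS q ↔ MildEstimate T B₀ μ S.compatibleData q := by
  constructor
  · rintro ⟨F, hd, hF, h⟩
    rw [← hd]
    refine mildEstimate_of_isISS hF (fun _ _ _ hx => hx.isMildSolution hT hμ B₀) (fun p hp => ?_) h
    rw [hd] at hp
    exact isLocLq_of_mem_compatibleData hp
  · intro h
    have hdef := isDefinedBy_isClassicalSolution hT hμ Subset.rfl h.exists_solution
    refine ⟨⟨mildControlFlow hT hμ B₀ _ h.exists_solution, fun t x u hxu => ?_⟩, rfl, hdef,
      h.isISS hT hμ⟩
    exact ((hdef x u hxu _).2 rfl).mem_compatibleData hxu t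

theorem mildISS_iff (hT : T.HasGenerator S.gen) (hμ : μ ∈ resolventSetOf S.gen)
    {inputs : Set (ℝ≥0 → U)} (hq : ∀ u ∈ inputs, IsLocLq q u)
    (hshift : ∀ u ∈ inputs, ∀ t, shiftBy t u ∈ inputs) :
    MildISS T B₀ μ inputs q ↔ MildEstimate T B₀ μ (univ ×ˢ inputs) q := by
  constructor
  · rintro ⟨F, hd, hF, h⟩
    rw [← hd]
    refine mildEstimate_of_isISS hF (fun _ _ _ => id) (fun p hp => ?_) h
    rw [hd] at hp
    exact hq _ hp.2
  · intro h
    refine ⟨⟨mildControlFlow hT hμ B₀ _ h.exists_solution,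
      fun t x u hxu => ⟨trivial, hshift u hxu.2 t⟩⟩, rfl, fun x₀ u hxu x => ?_, h.isISS hT hμ⟩
    refine ⟨fun hx => hx.eq_mildFlow hT hμ, fun hx => ?_⟩
    rw [hx]
    exact isMildSolution_mildFlow hT hμ (h.exists_solution _ hxu)

end BoundaryControlSystem

end

/-! ### The equivalences -/

open BoundaryControlSystem

theorem mainTheorem4 {X U : Type*}
    [NormedAddCommGroup X] [NormedSpace ℂ X] [CompleteSpace X]
    [NormedAddCommGroup U] [NormedSpace ℂ U] [CompleteSpace U]
    (S : BoundaryControlSystem X U)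
    (T : C0Semigroup X) (hT : T.HasGenerator S.gen)
    (B₀ : S.RightInverse)
    (μ : ℂ) (hμ : μ ∈ resolventSetOf S.gen) :
    (∀ q : ℝ≥0∞, 1 ≤ q → q ≠ ⊤ →
      [S.ClassicalTestISS q,
       BoundaryControlSystem.MildISS T B₀ μ {u | IsLocLq q u} q,
       S.ClassicalCompatibleISS q].TFAE) ∧
    (S.ClassicalCompatibleISS ⊤ ↔
      BoundaryControlSystem.MildISS T B₀ μ {u | Continuous u} ⊤) := by
  refine ⟨fun q hq hq' => ?_, ?_⟩
  · rw [classicalTestISS_iff hT hμ B₀, classicalCompatibleISS_iff hT hμ B₀,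
      mildISS_iff hT hμ (inputs := {u | IsLocLq q u}) (fun _ h => h)
        (fun _ h t => IsLocLq.shiftBy h t)]
    -- The only implication with analytic content; the other two restrict the estimate along the
    -- inclusions of the data sets.
    tfae_have 1 → 2 := fun h => h.of_approx hT hμ hq (fun p hp p' hp' => sub_mem_testData hp hp')
      (fun p hp => isLocLq_of_mem_compatibleData (testData_subset_compatibleData hp))
      (fun p hp => hp.2)
      (fun p hp t ε hε => exists_mem_testData_approx hT hq hq' hp.2 p.1 t hε)
    tfae_have 2 → 3 := fun h => h.mono fun p hp => ⟨trivial, isLocLq_of_mem_compatibleData hp⟩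
    tfae_have 3 → 1 := fun h => h.mono testData_subset_compatibleData
    tfae_finish
  · rw [classicalCompatibleISS_iff hT hμ B₀,
      mildISS_iff hT hμ (inputs := {u | Continuous u}) (fun _ h => isLocLq_of_continuous h)
        (fun _ h t => Continuous.comp h (continuous_const_add t))]
    exact ⟨fun h => h.of_approx hT hμ le_top (fun p hp p' hp' => sub_mem_compatibleData hp hp')
      (fun p hp => isLocLq_of_mem_compatibleData hp) (fun p hp => isLocLq_of_continuous hp.2)
      (fun p hp t ε hε => exists_mem_compatibleData_approx hT hμ B₀ hp.2 p.1 t hε),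
      fun h => h.mono fun p hp => ⟨trivial, hp.2.continuous⟩⟩
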